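/- Let $\mathbb{R}_+=[0,\infty)$. Write $f\in L_{2,loc}(\mathbb{R}_+)$ if $f\in L_2[0,b]$ for every $b>0$, and $f\in AC_{loc}(\mathbb{R}_+)$ if $f$ is absolutely continuous on $[0,b]$ for every $b>0$. For a complex-valued $s\in L_{2,loc}(\mathbb{R}_+)$ put $$y^{[1]}=y'-sy,\qquad l(y)=-(y^{[1]})'-s\,y^{[1]}-s^2y ,$$ which is a regularization of $-y''+qy$ with the potential $q=s'$ (derivative in the sense of distributions); $s$ is called a generalized antiderivative of the potential. The minimal operator $L_0$ constructed from $s$ acts in $L_2(\mathbb{R}_+)$ by $L_0y=l(y)$ on the domain $$\mathscr{D}_0=\{y\in L_2(\mathbb{R}_+):\ y,\,y^{[1]}\in AC_{loc}(\mathbb{R}_+),\ l(y)\in L_2(\mathbb{R}_+),\ y(0)=y^{[1]}(0)=0,\ \operatorname{supp}y \text{ is compact}\}.$$ It is called semi-bounded if there is $m\in\mathbb{R}$ such that $(L_0y,y)$ is real and $(L_0y,y)\ge m$ for all $y\in\mathscr{D}_0$ with $\|y\|=1$. **Lemma.** Let $s\in L_{2,loc}(\mathbb{R}_+)$ be complex-valued.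 The minimal operator $L_0$ constructed from $s$ is semi-bounded if and only if there exist a real-valued $\gamma\in L_{2,loc}(\mathbb{R}_+)$, a constant $b\in\mathbb{R}$ and a constant of integration $C\in\mathbb{C}$ such that $$s(x)=bx+\gamma(x)+\int_0^x\gamma^2(t)\,dt+C\qquad\text{for almost all }x\in\mathbb{R}_+ .$$ -/

import Mathlib

open MeasureTheory Set

/-- Lebesgue measure on the half-line `ℝ₊ = [0, ∞)`. -/
noncomputable abbrev halfLine : Measure ℝ := volume.restrict (Ici (0 : ℝ))

/-- The complex Hilbert space `L₂(ℝ₊)`. -/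
abbrev L2HalfLine : Type := Lp ℂ 2 halfLine

/-- `f ∈ L_{2,loc}(ℝ₊)`: `f` is square integrable on `[0, b]` for every `b`. -/
def MemL2Loc {E : Type*} [NormedAddCommGroup E] (f : ℝ → E) : Prop :=
  ∀ b : ℝ, MemLp f 2 (volume.restrict (Icc (0 : ℝ) b))

/-- `f ∈ AC_loc(ℝ₊)`: `f` is absolutely continuous on `[0, b]` for every `b ≥ 0`. -/
def ACLoc (f : ℝ → ℂ) : Prop :=
  ∀ b : ℝ, 0 ≤ b → AbsolutelyContinuousOnInterval f 0 b

/-- The quasi-derivative `y^{[1]} = y' - s y`. -/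
noncomputable def quasiDeriv (s y : ℝ → ℂ) (x : ℝ) : ℂ := deriv y x - s x * y x

/-- The differential expression `l(y) = -(y^{[1]})' - s y^{[1]} - s² y`, with `z = y^{[1]}`. -/
noncomputable def diffExpr (s y z : ℝ → ℂ) (x : ℝ) : ℂ :=
  -deriv z x - s x * z x - s x ^ 2 * y x

/-- `(u, v)` lies in the graph of the maximal operator, i.e. `u ∈ 𝒟` and `v = l(u) ∈ L₂(ℝ₊)`.
Here `y` is the locally absolutely continuous representative of the class `u`, and `z` is the
locally absolutely continuous representative of its quasi-derivative. -/
structure MaximalPair (s : ℝ → ℂ) (u v : L2HalfLine) (y z : ℝ → ℂ) : Prop where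
  rep : u =ᵐ[halfLine] y
  ac : ACLoc y
  quasi_ac : ACLoc z
  quasi_eq : z =ᵐ[halfLine] quasiDeriv s y
  expr_eq : v =ᵐ[halfLine] diffExpr s y z

/-- `(u, v)` lies in the graph of the minimal operator: in addition `y(0) = y^{[1]}(0) = 0` and the
support of `y` in `[0, ∞)` is compact. -/
structure MinimalPair (s : ℝ → ℂ) (u v : L2HalfLine) (y z : ℝ → ℂ) : Prop
    extends MaximalPair s u v y z where
  init : y 0 = 0
  quasi_init : z 0 = 0
  compact_supp : ∃ b : ℝ, ∀ x : ℝ, b < x → 0 ≤ x → y x = 0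

theorem ACLoc.add {f g : ℝ → ℂ} (hf : ACLoc f) (hg : ACLoc g) : ACLoc (f + g) :=
  fun b hb => (hf b hb).add (hg b hb)

theorem ACLoc.const_smul {f : ℝ → ℂ} (hf : ACLoc f) (c : ℂ) : ACLoc (c • f) :=
  fun b hb => (hf b hb).const_smul c

theorem ACLoc.zero : ACLoc 0 := fun b _ =>
  ((LipschitzWith.const (0 : ℂ)).lipschitzOnWith (s := uIcc 0 b)).absolutelyContinuousOnInterval

theorem ACLoc.continuousOn {f : ℝ → ℂ} (hf : ACLoc f) : ContinuousOn f (Ici 0) := by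
  intro x hx
  have hx' : (0 : ℝ) ≤ x := hx
  have h := (hf (x + 1) (by linarith)).continuousOn
  rw [uIcc_of_le (by linarith)] at h
  refine (h x ⟨hx', by linarith⟩).mono_of_mem_nhdsWithin ?_
  have : Ici (0 : ℝ) ∩ Iio (x + 1) ⊆ Icc 0 (x + 1) := fun t ht => ⟨ht.1, le_of_lt ht.2⟩
  exact Filter.mem_of_superset (inter_mem_nhdsWithin _ (Iio_mem_nhds (by linarith))) this

theorem ae_pos_halfLine : ∀ᵐ x ∂halfLine, 0 < x := by
  have h : ∀ᵐ x : ℝ ∂halfLine, x ≠ 0 := by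
    refine ae_restrict_of_ae ?_
    simp [ae_iff]
  filter_upwards [h, ae_restrict_mem measurableSet_Ici] with x h1 h2
  exact lt_of_le_of_ne h2 (Ne.symm h1)

theorem ACLoc.ae_differentiableAt {f : ℝ → ℂ} (hf : ACLoc f) :
    ∀ᵐ x ∂halfLine, DifferentiableAt ℝ f x := by
  have h : ∀ n : ℕ, ∀ᵐ x : ℝ, x ∈ uIcc (0 : ℝ) n → DifferentiableAt ℝ f x := fun n =>
    (hf n (Nat.cast_nonneg n)).boundedVariationOn.ae_differentiableAt_of_mem_uIcc
  filter_upwards [ae_restrict_of_ae (ae_all_iff.2 h), ae_pos_halfLine] with x hx hpos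
  obtain ⟨n, hn⟩ := exists_nat_ge x
  exact hx n (by rw [uIcc_of_le (Nat.cast_nonneg n)]; exact ⟨hpos.le, hn⟩)

theorem eqOn_zero_of_ae {f : ℝ → ℂ} (hf : ACLoc f) (h : f =ᵐ[halfLine] 0) :
    ∀ x, 0 ≤ x → f x = 0 := by
  have h1 : f =ᵐ[volume.restrict (Ioi (0 : ℝ))] (fun _ => 0) :=
    ae_restrict_of_ae_restrict_of_subset Ioi_subset_Ici_self h
  have hc := hf.continuousOn
  have h2 : EqOn f (fun _ => 0) (Ioi 0) :=
    Measure.eqOn_open_of_ae_eq h1 isOpen_Ioi (hc.mono Ioi_subset_Ici_self) continuousOn_const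
  have h3 : EqOn f (fun _ => 0) (Ici 0) :=
    h2.of_subset_closure hc continuousOn_const Ioi_subset_Ici_self (by rw [closure_Ioi])
  exact fun x hx => h3 hx

theorem deriv_zero_of_eqOn {f : ℝ → ℂ} (h : ∀ x, 0 ≤ x → f x = 0) :
    ∀ x, 0 < x → deriv f x = 0 := by
  intro x hx
  have : f =ᶠ[nhds x] fun _ => 0 := by
    filter_upwards [Ioi_mem_nhds hx] with t ht using h t (le_of_lt ht)
  rw [this.deriv_eq]; simp

/-- The graph `{(y, l(y)) : y ∈ 𝒟₀}` of the minimal operator, a subspace of `L₂(ℝ₊) × L₂(ℝ₊)`. -/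
def minimalGraph (s : ℝ → ℂ) : Submodule ℂ (L2HalfLine × L2HalfLine) where
  carrier := {p | ∃ y z : ℝ → ℂ, MinimalPair s p.1 p.2 y z}
  zero_mem' := by
    refine ⟨0, 0, ⟨⟨Lp.coeFn_zero _ _ _, ACLoc.zero, ACLoc.zero, ?_, ?_⟩, rfl, rfl, ⟨0, fun _ _ _ => rfl⟩⟩⟩
    · exact Filter.Eventually.of_forall fun x => by
        simp [quasiDeriv, deriv_zero]
    · filter_upwards [Lp.coeFn_zero ℂ 2 halfLine] with x hx
      simp only [Prod.snd_zero]
      rw [hx]; simp [diffExpr, deriv_zero]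
  add_mem' := by
    rintro p q ⟨y, z, h⟩ ⟨y', z', h'⟩
    refine ⟨y + y', z + z', ⟨⟨?_, h.ac.add h'.ac, h.quasi_ac.add h'.quasi_ac, ?_, ?_⟩, ?_, ?_, ?_⟩⟩
    · exact (Lp.coeFn_add _ _).trans (h.rep.add h'.rep)
    · filter_upwards [h.quasi_eq, h'.quasi_eq, h.ac.ae_differentiableAt,
        h'.ac.ae_differentiableAt] with x h1 h2 h3 h4
      simp only [Pi.add_apply, h1, h2, quasiDeriv, deriv_add h3 h4]
      ring
    · filter_upwards [Lp.coeFn_add p.2 q.2, h.expr_eq, h'.expr_eq,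
        h.quasi_ac.ae_differentiableAt, h'.quasi_ac.ae_differentiableAt] with x h0 h1 h2 h3 h4
      simp only [Prod.snd_add, h0, Pi.add_apply, h1, h2, diffExpr, deriv_add h3 h4]
      ring
    · simp [h.init, h'.init]
    · simp [h.quasi_init, h'.quasi_init]
    · obtain ⟨b, hb⟩ := h.compact_supp
      obtain ⟨b', hb'⟩ := h'.compact_supp
      refine ⟨max b b', fun x hx h0 => ?_⟩
      simp [hb x ((le_max_left _ _).trans_lt hx) h0, hb' x ((le_max_right _ _).trans_lt hx) h0]
  smul_mem' := by
    rintro c p ⟨y, z, h⟩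
    refine ⟨c • y, c • z, ⟨⟨?_, h.ac.const_smul c, h.quasi_ac.const_smul c, ?_, ?_⟩, ?_, ?_, ?_⟩⟩
    · exact (Lp.coeFn_smul _ _).trans (h.rep.const_smul c)
    · filter_upwards [h.quasi_eq, h.ac.ae_differentiableAt] with x h1 h3
      simp only [Pi.smul_apply, h1, quasiDeriv, deriv_const_smul c h3, smul_eq_mul]
      ring
    · filter_upwards [Lp.coeFn_smul c p.2, h.expr_eq,
        h.quasi_ac.ae_differentiableAt] with x h0 h1 h3
      simp only [Prod.smul_snd, h0, Pi.smul_apply, h1, diffExpr, deriv_const_smul c h3, smul_eq_mul]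
      ring
    · simp [h.init]
    · simp [h.quasi_init]
    · obtain ⟨b, hb⟩ := h.compact_supp
      exact ⟨b, fun x hx h0 => by simp [hb x hx h0]⟩

/-- `l(y)` depends only on the class of `y` in `L₂(ℝ₊)`, so `minimalGraph s` is indeed the graph
of an operator. -/
theorem minimalGraph_single_valued (s : ℝ → ℂ) (p : L2HalfLine × L2HalfLine)
    (hp : p ∈ minimalGraph s) (hp0 : p.1 = 0) : p.2 = 0 := by
  obtain ⟨y, z, h⟩ := hp
  have hy : y =ᵐ[halfLine] 0 := by
    have h1 := h.rep
    rw [hp0] at h1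
    exact h1.symm.trans (Lp.coeFn_zero _ _ _)
  have hy0 := eqOn_zero_of_ae h.ac hy
  have hz : z =ᵐ[halfLine] 0 := by
    filter_upwards [h.quasi_eq, ae_pos_halfLine] with x hx hpos
    simp [hx, quasiDeriv, hy0 x hpos.le, deriv_zero_of_eqOn hy0 x hpos]
  have hz0 := eqOn_zero_of_ae h.quasi_ac hz
  refine Lp.ext ?_
  filter_upwards [h.expr_eq, ae_pos_halfLine, Lp.coeFn_zero ℂ 2 halfLine] with x hx hpos h0
  rw [hx, h0]
  simp [diffExpr, hy0 x hpos.le, hz0 x hpos.le, deriv_zero_of_eqOn hz0 x hpos]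

/-- The minimal operator `L₀ y = l(y)`, `y ∈ 𝒟₀`, in `L₂(ℝ₊)`, for the potential `s'`. -/
noncomputable def minimalOperator (s : ℝ → ℂ) : L2HalfLine →ₗ.[ℂ] L2HalfLine :=
  (minimalGraph s).toLinearPMap

theorem minimalOperator_graph (s : ℝ → ℂ) : (minimalOperator s).graph = minimalGraph s :=
  (minimalGraph s).toLinearPMap_graph_eq fun p hp h0 => minimalGraph_single_valued s p hp h0

/-- The closed sector `{z₀ + z : arg z ∈ [α, β]}` (including its vertex). -/
def sector (α β : ℝ) (z₀ : ℂ) : Set ℂ :=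
  {w | ∃ r : ℝ, 0 ≤ r ∧ ∃ θ ∈ Icc α β, w = z₀ + r * Complex.exp (θ * Complex.I)}

/-- An operator is semi-bounded if its numerical range lies in a sector with zero angles and a real
vertex. The inner product of Mathlib is linear in its second argument. -/
def IsSemibounded {H : Type*} [NormedAddCommGroup H] [InnerProductSpace ℂ H]
    (T : H →ₗ.[ℂ] H) : Prop :=
  ∃ m : ℝ, ∀ y : T.domain, ‖(y : H)‖ = 1 → inner ℂ (y : H) (T y) ∈ sector 0 0 (m : ℂ)

/-! If `s = γ + τ` with `τ = bx + ∫γ² + C`, put `k = y^{[1]} + τy`. Then `y' = γy + k`, and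
integrating the derivative of `ȳk` over the support gives `⟨y, l(y)⟩ = ∫|k|² + b‖y‖²`. This
completed square is the whole of `isSemibounded_of_representation`.

Conversely, a real form makes `L₀` symmetric by polarization, and this alone forces `Im s` to be
constant (`exists_ae_im_eq_const`). Near any point some solution `u` of `l(u) = 0` is nonzero. For
`y = ug` with `g' = G/u²` one finds `l(y) = -G'/u`, so symmetry can be tested on explicit functions.
It yields `(ū/u)' = κ/u²` locally, from which `s̄ - s` agrees a.e. with an absolutely continuous
function whose derivative is zero.

Removing the imaginary constant and a linear term leaves a real `σ` whose form is at least `‖y‖²`. A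
complex solution `ψ` that is nowhere proportional to a real one never vanishes, and `ψ = |ψ|e^{iθ}`
with `θ' = |ψ|⁻²`. On `y = |ψ|φ(θ)` the form becomes `∫(φ'² - φ²) dθ` (`PhaseSolution.form_le`).
Comparison with sines shows that the total phase stays below some `M < π`
(`PhaseSolution.exists_phase_bound`). The strict gap comes from the margin `‖y‖²`. It leaves room
for a rotation `δ > 0` such that the real solution `Im(e^{iδ}ψ)` has no zero on the closed
half-line, the origin included. Its logarithmic derivative is `γ`, and the Riccati equation for the
quotient of quasi-derivative and solution integrates to the representation
(`exists_riccati_of_form_ge`). -/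

/-! ### Calculus of locally absolutely continuous functions -/

theorem AbsolutelyContinuousOnInterval.of_dist_le {X Y : Type*} [PseudoMetricSpace X]
    [PseudoMetricSpace Y] {f : ℝ → X} {g : ℝ → Y} {a b C : ℝ}
    (hf : AbsolutelyContinuousOnInterval f a b)
    (h : ∀ x ∈ uIcc a b, ∀ y ∈ uIcc a b, dist (g x) (g y) ≤ C * dist (f x) (f y)) :
    AbsolutelyContinuousOnInterval g a b := by
  have h0 := Filter.Tendsto.const_mul C hf
  rw [mul_zero] at h0
  refine squeeze_zero' (Filter.Eventually.of_forall fun E => Finset.sum_nonneg fun i _ =>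
    dist_nonneg) ?_ h0
  refine Filter.mem_inf_of_right (Filter.mem_principal.2 ?_)
  intro E hE
  change _ ≤ C * _
  rw [Finset.mul_sum]
  exact Finset.sum_le_sum fun i hi => h _ (hE.1 i hi).1 _ (hE.1 i hi).2

/-- `f` is locally absolutely continuous on `[0, ∞)`, with almost everywhere derivative `f'`. -/
structure HasACDeriv (f f' : ℝ → ℂ) : Prop where
  ac : ACLoc f
  deriv : ∀ᵐ x ∂halfLine, HasDerivAt f (f' x) x

theorem ae_halfLine_of_ae_Ioi {p : ℝ → Prop} (h : ∀ᵐ x, 0 < x → p x) : ∀ᵐ x ∂halfLine, p x := by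
  filter_upwards [ae_restrict_of_ae h, ae_pos_halfLine] with x h1 h2 using h1 h2

theorem ae_of_ae_halfLine {p : ℝ → Prop} (h : ∀ᵐ x ∂halfLine, p x) : ∀ᵐ x, 0 ≤ x → p x :=
  (ae_restrict_iff' measurableSet_Ici).1 h

theorem ACLoc.hasACDeriv {f : ℝ → ℂ} (hf : ACLoc f) : HasACDeriv f (deriv f) :=
  ⟨hf, hf.ae_differentiableAt.mono fun _ hx => hx.hasDerivAt⟩

theorem ACLoc.congr {f g : ℝ → ℂ} (hf : ACLoc f) (h : ∀ x, 0 ≤ x → g x = f x) : ACLoc g := by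
  intro b hb
  refine (hf b hb).of_dist_le (C := 1) fun x hx y hy => ?_
  rw [uIcc_of_le hb] at hx hy
  rw [h x hx.1, h y hy.1, one_mul]

namespace HasACDeriv

variable {f f' g g' : ℝ → ℂ}

theorem congr (hf : HasACDeriv f f') (h : ∀ x, 0 ≤ x → g x = f x)
    (h' : ∀ᵐ x ∂halfLine, g' x = f' x) : HasACDeriv g g' := by
  refine ⟨hf.ac.congr h, ?_⟩
  filter_upwards [hf.deriv, h', ae_pos_halfLine] with x h1 h2 h3
  rw [h2]
  refine h1.congr_of_eventuallyEq ?_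
  filter_upwards [Ioi_mem_nhds h3] with t ht using h t (le_of_lt ht)

theorem congr_deriv (hf : HasACDeriv f f') (h' : ∀ᵐ x ∂halfLine, g' x = f' x) :
    HasACDeriv f g' :=
  hf.congr (fun _ _ => rfl) h'

theorem add (hf : HasACDeriv f f') (hg : HasACDeriv g g') :
    HasACDeriv (fun x => f x + g x) (fun x => f' x + g' x) := by
  refine ⟨hf.ac.add hg.ac, ?_⟩
  filter_upwards [hf.deriv, hg.deriv] with x h1 h2 using h1.add h2

theorem mul (hf : HasACDeriv f f') (hg : HasACDeriv g g') :
    HasACDeriv (fun x => f x * g x) (fun x => f' x * g x + f x * g' x) := by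
  refine ⟨fun b hb => (hf.ac b hb).smul (hg.ac b hb), ?_⟩
  filter_upwards [hf.deriv, hg.deriv] with x h1 h2 using h1.mul h2

theorem const (c : ℂ) : HasACDeriv (fun _ => c) (fun _ => 0) := by
  refine ⟨fun b _ => ?_, Filter.Eventually.of_forall fun x => hasDerivAt_const x c⟩
  exact ((LipschitzWith.const c).lipschitzOnWith (s := uIcc 0 b)).absolutelyContinuousOnInterval

theorem const_mul (c : ℂ) (hf : HasACDeriv f f') :
    HasACDeriv (fun x => c * f x) (fun x => c * f' x) :=
  ((const c).mul hf).congr_deriv (Filter.Eventually.of_forall fun x => by simp)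

theorem neg (hf : HasACDeriv f f') : HasACDeriv (fun x => -f x) (fun x => -f' x) :=
  (hf.const_mul (-1)).congr (fun _ _ => by ring) (Filter.Eventually.of_forall fun x => by ring)

theorem sub (hf : HasACDeriv f f') (hg : HasACDeriv g g') :
    HasACDeriv (fun x => f x - g x) (fun x => f' x - g' x) :=
  (hf.add hg.neg).congr (fun _ _ => by ring) (Filter.Eventually.of_forall fun x => by ring)

theorem continuousOn (hf : HasACDeriv f f') : ContinuousOn f (Ici 0) := hf.ac.continuousOn

theorem star (hf : HasACDeriv f f') :
    HasACDeriv (fun x => starRingEnd ℂ (f x)) (fun x => starRingEnd ℂ (f' x)) := by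
  refine ⟨fun b hb => (hf.ac b hb).of_dist_le (C := 1) fun x _ y _ => ?_, ?_⟩
  · rw [one_mul, Complex.dist_eq, Complex.dist_eq, ← map_sub, RCLike.norm_conj]
  · filter_upwards [hf.deriv] with x h1
    exact h1.star_conj

/-- An entire function is Lipschitz on the compact image of each `[0, b]`, which is enough for
absolute continuity of the composite. -/
theorem comp (hf : HasACDeriv f f') {φ φ' : ℂ → ℂ} (h : ∀ x, HasDerivAt φ (φ' x) x) :
    HasACDeriv (fun x => φ (f x)) (fun x => φ' (f x) * f' x) := by
  refine ⟨fun b hb => ?_, ?_⟩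
  · have hφ : ContDiff ℂ 1 φ :=
      (Differentiable.contDiff fun x => (h x).differentiableAt)
    have hc : IsCompact (f '' Icc 0 b) :=
      isCompact_Icc.image_of_continuousOn (hf.continuousOn.mono Icc_subset_Ici_self)
    obtain ⟨K, hK⟩ := (hφ.locallyLipschitz.locallyLipschitzOn
      (s := f '' Icc 0 b)).exists_lipschitzOnWith_of_compact hc
    refine (hf.ac b hb).of_dist_le (C := K) fun x hx y hy => ?_
    rw [uIcc_of_le hb] at hx hy
    exact hK.dist_le_mul _ (mem_image_of_mem _ hx) _ (mem_image_of_mem _ hy)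
  · filter_upwards [hf.deriv] with x h1
    exact (h (f x)).comp_of_eq x h1 rfl

theorem inv (hf : HasACDeriv f f') (h0 : ∀ x, 0 ≤ x → f x ≠ 0) :
    HasACDeriv (fun x => (f x)⁻¹) (fun x => -f' x / f x ^ 2) := by
  refine ⟨fun b hb => ?_, ?_⟩
  · have hc : ContinuousOn (fun x => (f x)⁻¹) (Icc 0 b) :=
      (hf.continuousOn.mono Icc_subset_Ici_self).inv₀ fun x hx => h0 x hx.1
    obtain ⟨C, hC⟩ := isCompact_Icc.exists_bound_of_continuousOn hc
    have hC0 : 0 ≤ C := (norm_nonneg _).trans (hC 0 ⟨le_rfl, hb⟩)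
    refine (hf.ac b hb).of_dist_le (C := C * C) fun x hx y hy => ?_
    rw [uIcc_of_le hb] at hx hy
    rw [dist_inv_inv₀ (h0 x hx.1) (h0 y hy.1), div_eq_mul_inv, mul_inv, ← norm_inv, ← norm_inv,
      mul_comm]
    have := hC x hx
    have := hC y hy
    gcongr
  · filter_upwards [hf.deriv, ae_pos_halfLine] with x h1 h2
    exact h1.fun_inv (h0 x h2.le)

theorem const_of_ae_zero_on {a b : ℝ} (ha : 0 ≤ a) (hab : a ≤ b) (hf : HasACDeriv f f')
    (h : ∀ᵐ x ∂halfLine, x ∈ Ioo a b → f' x = 0) : ∃ C, ∀ x ∈ Icc a b, f x = C := by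
  have h1 := ((hf.ac b (ha.trans hab)).mono (c := a) (d := b)
    (uIcc_subset_uIcc (by rw [uIcc_of_le (ha.trans hab)]; exact ⟨ha, hab⟩) right_mem_uIcc))
  have h2 : ∀ᵐ x : ℝ, x ∉ ({a, b} : Set ℝ) := by
    refine (measure_eq_zero_iff_ae_notMem).1 ?_
    exact (Set.toFinite _).measure_zero _
  obtain ⟨C, hC⟩ := h1.const_of_ae_hasDerivAt_zero (by
    filter_upwards [ae_of_ae_halfLine h, ae_of_ae_halfLine hf.deriv, h2] with x h1 h2 h3 hx
    rw [uIcc_of_le hab] at hx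
    simp only [mem_insert_iff, mem_singleton_iff, not_or] at h3
    have := h2 (ha.trans hx.1)
    rwa [h1 (ha.trans hx.1) ⟨lt_of_le_of_ne hx.1 (Ne.symm h3.1), lt_of_le_of_ne hx.2 h3.2⟩] at this)
  rw [uIcc_of_le hab] at hC
  exact ⟨C, hC⟩

theorem eq_of_ae_zero (hf : HasACDeriv f f') (h : ∀ᵐ x ∂halfLine, f' x = 0) {x : ℝ}
    (hx : 0 ≤ x) : f x = f 0 := by
  obtain ⟨C, hC⟩ := hf.const_of_ae_zero_on le_rfl hx (h.mono fun x h _ => h)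
  rw [hC x ⟨hx, le_rfl⟩, hC 0 ⟨le_rfl, hx⟩]

theorem integral (hf : ∀ b, 0 ≤ b → IntervalIntegrable f volume 0 b) :
    HasACDeriv (fun x => ∫ t in (0 : ℝ)..x, f t) f := by
  constructor
  · intro b hb
    have h1 := (hf b hb)
    have hr : IntervalIntegrable (fun x => (f x).re) volume 0 b := ⟨h1.1.re, h1.2.re⟩
    have hi : IntervalIntegrable (fun x => (f x).im) volume 0 b := ⟨h1.1.im, h1.2.im⟩
    have hr' := hr.absolutelyContinuousOnInterval_intervalIntegral (c := 0) left_mem_uIcc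
    have hi' := hi.absolutelyContinuousOnInterval_intervalIntegral (c := 0) left_mem_uIcc
    have hr2 : AbsolutelyContinuousOnInterval
        (fun x => ((∫ t in (0 : ℝ)..x, (f t).re : ℝ) : ℂ)) 0 b :=
      hr'.of_dist_le (C := 1) fun x _ y _ => by
        rw [one_mul, Complex.dist_eq, Real.dist_eq, ← Complex.ofReal_sub, Complex.norm_real,
          Real.norm_eq_abs]
    have hi2 : AbsolutelyContinuousOnInterval
        (fun x => ((∫ t in (0 : ℝ)..x, (f t).im : ℝ) : ℂ)) 0 b :=
      hi'.of_dist_le (C := 1) fun x _ y _ => by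
        rw [one_mul, Complex.dist_eq, Real.dist_eq, ← Complex.ofReal_sub, Complex.norm_real,
          Real.norm_eq_abs]
    refine (hr2.add (hi2.const_smul Complex.I)).of_dist_le (C := 1) fun x hx y hy => ?_
    have key : ∀ x ∈ uIcc 0 b, (∫ t in (0 : ℝ)..x, f t) =
        ((∫ t in (0 : ℝ)..x, (f t).re : ℝ) : ℂ)
          + Complex.I • ((∫ t in (0 : ℝ)..x, (f t).im : ℝ) : ℂ) := by
      intro x hx
      have hx' : IntervalIntegrable f volume 0 x :=
        h1.mono_set (uIcc_subset_uIcc left_mem_uIcc hx)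
      have e1 := RCLike.intervalIntegral_ofReal (𝕜 := ℂ) (a := 0) (b := x) (μ := volume)
        (f := fun t => (f t).re)
      have e2 := RCLike.intervalIntegral_ofReal (𝕜 := ℂ) (a := 0) (b := x) (μ := volume)
        (f := fun t => (f t).im)
      simp only [RCLike.ofReal_eq_complex_ofReal] at e1 e2
      rw [← e1, ← e2, ← intervalIntegral.integral_smul, ← intervalIntegral.integral_add]
      · refine intervalIntegral.integral_congr fun t _ => ?_
        simp only [smul_eq_mul]
        rw [mul_comm, Complex.re_add_im]
      · exact ⟨hx'.1.re.ofReal, hx'.2.re.ofReal⟩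
      · exact IntervalIntegrable.smul (f := fun t => ((f t).im : ℂ))
          ⟨hx'.1.im.ofReal, hx'.2.im.ofReal⟩ Complex.I
    rw [key x hx, key y hy, one_mul]
    rfl
  · refine ae_halfLine_of_ae_Ioi ?_
    have h : ∀ n : ℕ, ∀ᵐ x : ℝ, x ∈ uIcc (0 : ℝ) n →
        HasDerivAt (fun x => ∫ t in (0 : ℝ)..x, f t) (f x) x := fun n => by
      filter_upwards [(hf n (Nat.cast_nonneg n)).ae_hasDerivAt_integral] with x hx h
      exact hx h 0 left_mem_uIcc
    filter_upwards [ae_all_iff.2 h] with x hx hpos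
    obtain ⟨n, hn⟩ := exists_nat_ge x
    exact hx n (by rw [uIcc_of_le (Nat.cast_nonneg n)]; exact ⟨hpos.le, hn⟩)

theorem intervalIntegrable (hf : HasACDeriv f f') {b : ℝ} (hb : 0 ≤ b) :
    IntervalIntegrable f' volume 0 b := by
  have hre : AbsolutelyContinuousOnInterval (fun x => (f x).re) 0 b :=
    (hf.ac b hb).of_dist_le (C := 1) fun x _ y _ => by
      rw [one_mul, Complex.dist_eq, Real.dist_eq, ← Complex.sub_re]
      exact Complex.abs_re_le_norm _
  have him : AbsolutelyContinuousOnInterval (fun x => (f x).im) 0 b :=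
    (hf.ac b hb).of_dist_le (C := 1) fun x _ y _ => by
      rw [one_mul, Complex.dist_eq, Real.dist_eq, ← Complex.sub_im]
      exact Complex.abs_im_le_norm _
  have h1 : IntervalIntegrable (fun x => ((_root_.deriv (fun x => (f x).re) x : ℝ) : ℂ)
      + ((_root_.deriv (fun x => (f x).im) x : ℝ) : ℂ) * Complex.I) volume 0 b := by
    refine IntervalIntegrable.add ?_ (IntervalIntegrable.mul_const ?_ _)
    · exact ⟨hre.intervalIntegrable_deriv.1.ofReal, hre.intervalIntegrable_deriv.2.ofReal⟩
    · exact ⟨him.intervalIntegrable_deriv.1.ofReal, him.intervalIntegrable_deriv.2.ofReal⟩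
  refine h1.congr_ae ?_
  rw [uIoc_of_le hb]
  refine (ae_restrict_iff' measurableSet_Ioc).2 ?_
  filter_upwards [ae_of_ae_halfLine hf.deriv] with x hx hxb
  have h2 := hx hxb.1.le
  have h3 : HasDerivAt (fun x => (f x).re) (f' x).re x := by
    exact Complex.reCLM.hasFDerivAt.comp_hasDerivAt x h2
  have h4 : HasDerivAt (fun x => (f x).im) (f' x).im x := by
    exact Complex.imCLM.hasFDerivAt.comp_hasDerivAt x h2
  simp only [h3.deriv, h4.deriv, Complex.re_add_im]

theorem integral_eq (hf : HasACDeriv f f') {b : ℝ} (hb : 0 ≤ b) :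
    ∫ t in (0 : ℝ)..b, f' t = f b - f 0 := by
  have h1 := (hf.sub (integral fun b hb => hf.intervalIntegrable hb)).eq_of_ae_zero
    (Filter.Eventually.of_forall fun x => sub_self _) hb
  simp only [intervalIntegral.integral_same, sub_zero] at h1
  rw [← h1]; ring

/-- Cutting off at a zero keeps a function absolutely continuous. -/
theorem indicator_Iic (hf : HasACDeriv f f') {N : ℝ} (hN : 0 ≤ N) (h0 : f N = 0) :
    HasACDeriv ((Iic N).indicator f) ((Iic N).indicator f') := by
  have hint : ∀ b, 0 ≤ b → IntervalIntegrable ((Iic N).indicator f') volume 0 b := by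
    intro b hb
    have := hf.intervalIntegrable hb
    exact ⟨this.1.indicator measurableSet_Iic, this.2.indicator measurableSet_Iic⟩
  have h1 : HasACDeriv (fun x => f 0 + ∫ t in (0 : ℝ)..x, (Iic N).indicator f' t)
      ((Iic N).indicator f') :=
    ((const (f 0)).add (integral hint)).congr_deriv (Filter.Eventually.of_forall fun x => by simp)
  refine h1.congr (fun x hx => ?_) (Filter.Eventually.of_forall fun _ => rfl)
  have e1 : ∀ x, 0 ≤ x → x ≤ N → (∫ t in (0 : ℝ)..x, (Iic N).indicator f' t) = f x - f 0 := by
    intro x hx hxN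
    rw [← hf.integral_eq hx]
    refine intervalIntegral.integral_congr fun t ht => ?_
    rw [uIcc_of_le hx] at ht
    exact indicator_of_mem (show t ∈ Iic N from ht.2.trans hxN) _
  by_cases hxN : x ≤ N
  · rw [e1 x hx hxN, indicator_of_mem (show x ∈ Iic N from hxN)]; ring
  · rw [indicator_of_notMem (show x ∉ Iic N from hxN)]
    push Not at hxN
    rw [← intervalIntegral.integral_add_adjacent_intervals (hint N hN)
      ((hint N hN).symm.trans (hint x hx)), e1 N hN le_rfl, h0]
    have : (∫ t in N..x, (Iic N).indicator f' t) = 0 := by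
      refine intervalIntegral.integral_zero_ae (Filter.Eventually.of_forall fun t ht => ?_)
      rw [uIoc_of_le hxN.le] at ht
      exact indicator_of_notMem (s := Iic N) (fun h => absurd ht.1 (not_lt.2 h)) _
    rw [this]; ring

theorem of_hasDerivAt (h : ∀ x, HasDerivAt f (f' x) x) (hc : Continuous f') :
    HasACDeriv f f' := by
  refine ⟨fun b _ => ?_, Filter.Eventually.of_forall h⟩
  refine ContDiffOn.absolutelyContinuousOnInterval (ContDiff.contDiffOn ?_)
  refine contDiff_one_iff_deriv.2 ⟨fun x => (h x).differentiableAt, ?_⟩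
  rwa [show _root_.deriv f = f' from funext fun x => (h x).deriv]

end HasACDeriv

/-! ### Linear systems with integrable coefficients -/

theorem hasSum_intervalIntegral_mul {Q : ℝ → ℂ} {x : ℝ} (hx : 0 ≤ x)
    (hQ : IntervalIntegrable Q volume 0 x) {f : ℕ → ℝ → ℂ} {F : ℝ → ℂ} {bd : ℕ → ℝ}
    (hf : ∀ n, ContinuousOn (f n) (Icc 0 x)) (hb : ∀ n, ∀ t ∈ Icc 0 x, ‖f n t‖ ≤ bd n)
    (hbd : Summable bd) (hF : ∀ t ∈ Icc 0 x, HasSum (fun n => f n t) (F t)) :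
    HasSum (fun n => ∫ t in (0 : ℝ)..x, Q t * f n t) (∫ t in (0 : ℝ)..x, Q t * F t) := by
  have hsub : ∀ t ∈ uIoc 0 x, t ∈ Icc 0 x := fun t ht => by
    rw [uIoc_of_le hx] at ht; exact Ioc_subset_Icc_self ht
  refine intervalIntegral.hasSum_integral_of_dominated_convergence (fun n t => ‖Q t‖ * bd n)
    (fun n => ?_) (fun n => ?_) ?_ ?_ ?_
  · have h := hQ.mul_continuousOn (g := f n) (by rw [uIcc_of_le hx]; exact hf n)
    exact h.def'.aestronglyMeasurable
  · refine Filter.Eventually.of_forall fun t ht => ?_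
    rw [norm_mul]
    exact mul_le_mul_of_nonneg_left (hb n t (hsub t ht)) (norm_nonneg _)
  · exact Filter.Eventually.of_forall fun t _ => hbd.mul_left _
  · simp only [tsum_mul_left]
    exact hQ.norm.mul_const _
  · exact Filter.Eventually.of_forall fun t ht => (hF t (hsub t ht)).mul_left _

/-- The iterated kernel operator of the system `a' = P c`, `c' = -V a`. -/
noncomputable def volterraStep (P V f : ℝ → ℂ) (x : ℝ) : ℂ :=
  ∫ t in (0 : ℝ)..x, P t * ∫ r in (0 : ℝ)..t, -V r * f r

section Volterra

variable {P V : ℝ → ℂ}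

theorem hasACDeriv_integral_mul (hV : ∀ b, 0 ≤ b → IntervalIntegrable V volume 0 b) {f : ℝ → ℂ}
    (hf : ContinuousOn f (Ici 0)) :
    HasACDeriv (fun t => ∫ r in (0 : ℝ)..t, V r * f r) (fun t => V t * f t) :=
  HasACDeriv.integral fun b hb => (hV b hb).mul_continuousOn
    (hf.mono (by rw [uIcc_of_le hb]; exact Icc_subset_Ici_self))

theorem intervalIntegrable_of_continuousOn_Ici {P : ℝ → ℂ} (hP : ContinuousOn P (Ici 0)) (b : ℝ)
    (hb : 0 ≤ b) : IntervalIntegrable P volume 0 b :=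
  (hP.mono (by rw [uIcc_of_le hb]; exact Icc_subset_Ici_self)).intervalIntegrable

theorem continuousOn_volterraStep (hP : ContinuousOn P (Ici 0))
    (hV : ∀ b, 0 ≤ b → IntervalIntegrable V volume 0 b) {f : ℝ → ℂ}
    (hf : ContinuousOn f (Ici 0)) : ContinuousOn (volterraStep P V f) (Ici 0) :=
  (hasACDeriv_integral_mul (intervalIntegrable_of_continuousOn_Ici hP)
    (hasACDeriv_integral_mul (fun b hb => (hV b hb).neg) hf).continuousOn).continuousOn

theorem norm_integral_neg_mul_le {f : ℝ → ℂ} {x B K : ℝ} (hx : 0 ≤ x)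
    (hV : IntervalIntegrable V volume 0 x) (hK : ∫ t in (0 : ℝ)..x, ‖V t‖ ≤ K)
    (hB : 0 ≤ B) (hf : ∀ t ∈ Icc 0 x, ‖f t‖ ≤ B) :
    ‖∫ t in (0 : ℝ)..x, -V t * f t‖ ≤ K * B := by
  calc ‖∫ t in (0 : ℝ)..x, -V t * f t‖ ≤ ∫ t in (0 : ℝ)..x, ‖V t‖ * B := by
        refine intervalIntegral.norm_integral_le_of_norm_le hx
          (Filter.Eventually.of_forall fun t ht => ?_) (hV.norm.mul_const _)
        rw [norm_mul, norm_neg]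
        exact mul_le_mul_of_nonneg_left (hf t (Ioc_subset_Icc_self ht)) (norm_nonneg _)
    _ = (∫ t in (0 : ℝ)..x, ‖V t‖) * B := intervalIntegral.integral_mul_const _ _
    _ ≤ K * B := mul_le_mul_of_nonneg_right hK hB

/-- The inner integral is estimated crudely by `K = ∫‖V‖`. The outer one, where `P` is bounded by
`p`, integrates the power of `x` and so produces the factorial. Thus integrability of `V` suffices
for the convergence of the Picard series. -/
theorem norm_volterraStep_iterate_le {f : ℝ → ℂ} {B p K A : ℝ}
    (hV : IntervalIntegrable V volume 0 B) (hK : ∫ t in (0 : ℝ)..B, ‖V t‖ = K)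
    (hP : ∀ t ∈ Icc 0 B, ‖P t‖ ≤ p) (hA : ∀ t ∈ Icc 0 B, ‖f t‖ ≤ A) (hp : 0 ≤ p) (hA0 : 0 ≤ A)
    (n : ℕ) : ∀ x ∈ Icc 0 B, ‖(volterraStep P V)^[n] f x‖ ≤ A * (p * K * x) ^ n / n.factorial := by
  induction n with
  | zero => intro x hx; simpa using hA x hx
  | succ n ih =>
    intro x hx
    rw [Function.iterate_succ_apply']
    have hK0 : 0 ≤ K := hK ▸ intervalIntegral.integral_nonneg (hx.1.trans hx.2)
      fun t _ => norm_nonneg _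
    have h1 : ∀ t ∈ Icc 0 x, ‖∫ r in (0 : ℝ)..t, -V r * (volterraStep P V)^[n] f r‖
        ≤ K * (A * (p * K * t) ^ n / n.factorial) := by
      intro t ht
      have htB : t ≤ B := ht.2.trans hx.2
      refine norm_integral_neg_mul_le ht.1 (hV.mono_set (uIcc_subset_uIcc left_mem_uIcc
        (by rw [uIcc_of_le (ht.1.trans htB)]; exact ⟨ht.1, htB⟩))) ?_ ?_ ?_
      · rw [← hK]
        refine intervalIntegral.integral_mono_interval le_rfl ht.1 htB
          (Filter.Eventually.of_forall fun _ => norm_nonneg _) hV.norm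
      · have := ht.1
        positivity
      · intro r hr
        refine (ih r ⟨hr.1, hr.2.trans htB⟩).trans ?_
        have := hr.1
        have := hr.2
        gcongr
    calc ‖volterraStep P V ((volterraStep P V)^[n] f) x‖
        ≤ ∫ t in (0 : ℝ)..x, p * (K * (A * (p * K * t) ^ n / n.factorial)) := by
          refine intervalIntegral.norm_integral_le_of_norm_le hx.1
            (Filter.Eventually.of_forall fun t ht => ?_) ?_
          · rw [norm_mul]
            exact mul_le_mul (hP t ⟨ht.1.le, ht.2.trans hx.2⟩) (h1 t (Ioc_subset_Icc_self ht))
              (norm_nonneg _) hp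
          · exact Continuous.intervalIntegrable (by fun_prop) _ _
      _ = ∫ t in (0 : ℝ)..x, (A * (p * K) ^ (n + 1) / n.factorial) * t ^ n := by
          refine intervalIntegral.integral_congr fun t _ => ?_
          ring
      _ = A * (p * K * x) ^ (n + 1) / (n + 1).factorial := by
          rw [intervalIntegral.integral_const_mul, integral_pow, Nat.factorial_succ]
          push_cast
          field_simp
          simp only [ne_eq, Nat.add_eq_zero_iff, one_ne_zero, and_false, not_false_eq_true, zero_pow,
            sub_zero]
          ring

/-- The linear system `a' = P c`, `c' = -V a` with `P` continuous and `V` locally integrable has a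
solution on `[0, ∞)` for all initial values. -/
theorem exists_linear_system_solution (hP : ContinuousOn P (Ici 0))
    (hV : ∀ b, 0 ≤ b → IntervalIntegrable V volume 0 b) (α β : ℂ) :
    ∃ a c : ℝ → ℂ, HasACDeriv a (fun x => P x * c x) ∧ HasACDeriv c (fun x => -V x * a x) ∧
      a 0 = α ∧ c 0 = β := by
  -- Eliminating `c` turns the system into `a = f0 + volterraStep P V a`, solved by the Neumann
  -- series of the iterates `T n`.
  set f0 : ℝ → ℂ := fun x => α + ∫ t in (0 : ℝ)..x, P t * β with hf0
  have hPc : HasACDeriv (fun x => ∫ t in (0 : ℝ)..x, P t * β) (fun x => P x * β) :=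
    hasACDeriv_integral_mul (intervalIntegrable_of_continuousOn_Ici hP) continuousOn_const
  have hf0c : ContinuousOn f0 (Ici 0) := continuousOn_const.add hPc.continuousOn
  set T : ℕ → ℝ → ℂ := fun n => (volterraStep P V)^[n] f0 with hT
  have hTc : ∀ n, ContinuousOn (T n) (Ici 0) := by
    intro n
    induction n with
    | zero => exact hf0c
    | succ n ih =>
      simp only [hT, Function.iterate_succ_apply']
      exact continuousOn_volterraStep hP hV ih
  have hbound : ∀ B, 0 ≤ B → ∃ bd : ℕ → ℝ, Summable bd ∧ ∀ n, ∀ x ∈ Icc 0 B, ‖T n x‖ ≤ bd n := by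
    intro B hB
    obtain ⟨p, hp⟩ := isCompact_Icc.exists_bound_of_continuousOn
      (hP.mono (Icc_subset_Ici_self : Icc 0 B ⊆ _))
    obtain ⟨A, hA⟩ := isCompact_Icc.exists_bound_of_continuousOn
      (hf0c.mono (Icc_subset_Ici_self : Icc 0 B ⊆ _))
    have hp0 : 0 ≤ p := (norm_nonneg _).trans (hp 0 ⟨le_rfl, hB⟩)
    have hA0 : 0 ≤ A := (norm_nonneg _).trans (hA 0 ⟨le_rfl, hB⟩)
    have hK0 : 0 ≤ ∫ t in (0 : ℝ)..B, ‖V t‖ := intervalIntegral.integral_nonneg hB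
      fun t _ => norm_nonneg _
    refine ⟨fun n => A * ((p * (∫ t in (0 : ℝ)..B, ‖V t‖) * B) ^ n / n.factorial),
      (Real.summable_pow_div_factorial _).mul_left _, fun n x hx => ?_⟩
    refine (norm_volterraStep_iterate_le (hV B hB) rfl hp hA hp0 hA0 n x hx).trans ?_
    have := hx.1
    have := hx.2
    rw [mul_div_assoc]
    beta_reduce
    gcongr
  set a : ℝ → ℂ := fun x => ∑' n, T n x with ha
  have hac : ContinuousOn a (Ici 0) := by
    intro x hx
    have hx0 : (0 : ℝ) ≤ x := hx
    obtain ⟨bd, hs, hb⟩ := hbound (x + 1) (by linarith)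
    have h := continuousOn_tsum (fun n => (hTc n).mono (Icc_subset_Ici_self : Icc 0 (x + 1) ⊆ _))
      hs hb
    refine (h x ⟨hx0, by linarith⟩).mono_of_mem_nhdsWithin ?_
    have : Ici (0 : ℝ) ∩ Iio (x + 1) ⊆ Icc 0 (x + 1) := fun t ht => ⟨ht.1, le_of_lt ht.2⟩
    exact Filter.mem_of_superset (inter_mem_nhdsWithin _ (Iio_mem_nhds (by linarith))) this
  have hasum : ∀ x, 0 ≤ x → HasSum (fun n => T n x) (a x) := by
    intro x hx
    obtain ⟨bd, hs, hb⟩ := hbound x hx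
    exact (Summable.of_norm_bounded hs fun n => hb n x ⟨hx, le_rfl⟩).hasSum
  have hV' : ∀ b, 0 ≤ b → IntervalIntegrable (fun x => -V x) volume 0 b := fun b hb => (hV b hb).neg
  have hI := hasACDeriv_integral_mul hV' hac
  have hIn := fun n => hasACDeriv_integral_mul hV' (hTc n)
  have hsum1 : ∀ x, 0 ≤ x → HasSum (fun n => ∫ t in (0 : ℝ)..x, -V t * T n t)
      (∫ t in (0 : ℝ)..x, -V t * a t) := by
    intro x hx
    obtain ⟨bd, hs, hb⟩ := hbound x hx
    exact hasSum_intervalIntegral_mul hx (hV' x hx)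
      (fun n => (hTc n).mono Icc_subset_Ici_self) hb hs fun t ht => hasum t ht.1
  have hsum2 : ∀ x, 0 ≤ x → HasSum (fun n => T (n + 1) x)
      (∫ t in (0 : ℝ)..x, P t * ∫ r in (0 : ℝ)..t, -V r * a r) := by
    intro x hx
    obtain ⟨bd, hs, hb⟩ := hbound x hx
    simp only [hT, Function.iterate_succ_apply']
    refine hasSum_intervalIntegral_mul hx (intervalIntegrable_of_continuousOn_Ici hP x hx)
      (bd := fun n => (∫ t in (0 : ℝ)..x, ‖V t‖) * bd n)
      (fun n => (hIn n).continuousOn.mono Icc_subset_Ici_self) (fun n t ht => ?_) (hs.mul_left _)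
      fun t ht => hsum1 t ht.1
    refine norm_integral_neg_mul_le ht.1 (hV t ht.1) ?_ ?_ ?_
    · exact intervalIntegral.integral_mono_interval le_rfl ht.1 ht.2
          (Filter.Eventually.of_forall fun _ => norm_nonneg _) (hV x hx).norm
    · exact (norm_nonneg _).trans (hb n 0 ⟨le_rfl, hx⟩)
    · exact fun r hr => hb n r ⟨hr.1, hr.2.trans ht.2⟩
  have haeq : ∀ x, 0 ≤ x → a x = α + ((∫ t in (0 : ℝ)..x, P t * β)
      + ∫ t in (0 : ℝ)..x, P t * ∫ r in (0 : ℝ)..t, -V r * a r) := by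
    intro x hx
    -- Splitting off the term `n = 0` of the series gives the integral equation.
    have h1 := (hasum x hx).unique ((hsum2 x hx).zero_add)
    rw [h1, ← add_assoc]
    rfl
  refine ⟨a, fun x => β + ∫ t in (0 : ℝ)..x, -V t * a t, ?_, ?_, ?_, by simp⟩
  · refine ((HasACDeriv.const α).add (hPc.add (hasACDeriv_integral_mul
      (intervalIntegrable_of_continuousOn_Ici hP) hI.continuousOn))).congr haeq
      (Filter.Eventually.of_forall fun x => ?_)
    ring
  · exact ((HasACDeriv.const β).add hI).congr_deriv (Filter.Eventually.of_forall fun x => by ring)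
  · rw [haeq 0 le_rfl]; simp

end Volterra

/-! ### Solutions of `l(u) = 0` -/

theorem MemL2Loc.intervalIntegrable {E : Type*} [NormedAddCommGroup E] {s : ℝ → E}
    (hs : MemL2Loc s) (b : ℝ) (hb : 0 ≤ b) : IntervalIntegrable s volume 0 b := by
  rw [intervalIntegrable_iff_integrableOn_Icc_of_le hb]
  exact (hs b).integrable (by norm_num)

theorem MemL2Loc.intervalIntegrable_sq {s : ℝ → ℂ}
    (hs : MemL2Loc s) (b : ℝ) (hb : 0 ≤ b) : IntervalIntegrable (fun x => s x ^ 2) volume 0 b := by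
  rw [intervalIntegrable_iff_integrableOn_Icc_of_le hb]
  refine (MemLp.integrable_mul (hs b) (hs b)).congr (Filter.Eventually.of_forall fun x => ?_)
  simp [sq]

/-- `u` solves `l(u) = 0` on `[0, ∞)`, and `w` is its quasi-derivative. -/
structure QuasiSolution (s u w : ℝ → ℂ) : Prop where
  fst : HasACDeriv u (fun x => s x * u x + w x)
  snd : HasACDeriv w (fun x => -s x * w x - s x ^ 2 * u x)

/-- With `S = ∫s`, the substitution `u = e^S a`, `w = e^{-S} c` removes the diagonal terms of the
first-order system. What remains is `a' = e^{-2S} c`, `c' = -s²e^{2S} a`, with one continuous and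
one locally integrable coefficient. -/
theorem MemL2Loc.exists_quasiSolution {s : ℝ → ℂ} (hs : MemL2Loc s) (α β : ℂ) :
    ∃ u w, QuasiSolution s u w ∧ u 0 = α ∧ w 0 = β := by
  have hS : HasACDeriv (fun x => ∫ t in (0 : ℝ)..x, s t) s :=
    HasACDeriv.integral hs.intervalIntegrable
  set S : ℝ → ℂ := fun x => ∫ t in (0 : ℝ)..x, s t with hSdef
  have hE : HasACDeriv (fun x => Complex.exp (S x)) (fun x => Complex.exp (S x) * s x) :=
    hS.comp Complex.hasDerivAt_exp
  have hE' : HasACDeriv (fun x => Complex.exp (-S x)) (fun x => Complex.exp (-S x) * -s x) :=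
    hS.neg.comp Complex.hasDerivAt_exp
  obtain ⟨a, c, ha, hc, ha0, hc0⟩ := exists_linear_system_solution
    (P := fun x => Complex.exp (-S x) ^ 2) (V := fun x => s x ^ 2 * Complex.exp (S x) ^ 2)
    (hE'.continuousOn.pow 2)
    (fun b hb => (hs.intervalIntegrable_sq b hb).mul_continuousOn ((hE.continuousOn.pow 2).mono
      (by rw [uIcc_of_le hb]; exact Icc_subset_Ici_self))) α β
  have hinv : ∀ x, Complex.exp (S x) * Complex.exp (-S x) = 1 := fun x => by
    rw [← Complex.exp_add]; simp
  refine ⟨fun x => Complex.exp (S x) * a x, fun x => Complex.exp (-S x) * c x, ⟨?_, ?_⟩, ?_, ?_⟩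
  · refine (hE.mul ha).congr_deriv (Filter.Eventually.of_forall fun x => ?_)
    linear_combination (-(Complex.exp (-S x)) * c x) * hinv x
  · refine (hE'.mul hc).congr_deriv (Filter.Eventually.of_forall fun x => ?_)
    linear_combination (s x ^ 2 * Complex.exp (S x) * a x) * hinv x
  · simp [S, ha0]
  · simp [S, hc0]

/-! ### The quadratic form and elements of the minimal graph -/

theorem inner_L2HalfLine_eq {f g : L2HalfLine} {y v : ℝ → ℂ} (hf : f =ᵐ[halfLine] y)
    (hg : g =ᵐ[halfLine] v) :
    inner ℂ f g = ∫ x, starRingEnd ℂ (y x) * v x ∂halfLine := by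
  rw [L2.inner_def]
  refine integral_congr_ae ?_
  filter_upwards [hf, hg] with x h1 h2
  rw [h1, h2, RCLike.inner_apply, mul_comm]

theorem ofReal_norm_sq_L2HalfLine_eq {f : L2HalfLine} {y : ℝ → ℂ} (hf : f =ᵐ[halfLine] y) :
    ((‖f‖ ^ 2 : ℝ) : ℂ) = ∫ x, starRingEnd ℂ (y x) * y x ∂halfLine := by
  rw [← inner_L2HalfLine_eq hf hf, inner_self_eq_norm_sq_to_K]
  simp

theorem integral_halfLine_eq {f : ℝ → ℂ} {N : ℝ} (hN : 0 ≤ N)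
    (h : ∀ᵐ x ∂halfLine, N < x → f x = 0) : ∫ x, f x ∂halfLine = ∫ x in (0 : ℝ)..N, f x := by
  rw [intervalIntegral.integral_of_le hN, ← integral_Icc_eq_integral_Ioc]
  refine setIntegral_eq_of_subset_of_ae_sdiff_eq_zero measurableSet_Ici.nullMeasurableSet
    Icc_subset_Ici_self ?_
  filter_upwards [ae_of_ae_halfLine h] with x hx hxm
  refine hx hxm.1 ?_
  by_contra hc
  exact hxm.2 ⟨hxm.1, not_lt.1 hc⟩

theorem mem_sector_zero_iff {m : ℝ} {w : ℂ} :
    w ∈ sector 0 0 (m : ℂ) ↔ ∃ r : ℝ, 0 ≤ r ∧ w = ((m + r : ℝ) : ℂ) := by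
  constructor
  · rintro ⟨r, hr, θ, hθ, rfl⟩
    have : θ = 0 := le_antisymm hθ.2 hθ.1
    exact ⟨r, hr, by simp [this]⟩
  · rintro ⟨r, hr, rfl⟩
    exact ⟨r, hr, 0, ⟨le_rfl, le_rfl⟩, by simp⟩

/-- Both sides of the bound are homogeneous of degree two, so normalization can be dropped. The
degenerate sector is the real ray starting at `m`. -/
theorem isSemibounded_minimalOperator_iff (s : ℝ → ℂ) :
    IsSemibounded (minimalOperator s) ↔ ∃ m : ℝ, ∀ p ∈ minimalGraph s,
      ∃ r : ℝ, 0 ≤ r ∧ inner ℂ p.1 p.2 = ((m * ‖p.1‖ ^ 2 + r : ℝ) : ℂ) := by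
  refine exists_congr fun m => ⟨fun h p hp => ?_, fun h y hy => ?_⟩
  · by_cases h0 : p.1 = 0
    · exact ⟨0, le_rfl, by simp [h0]⟩
    · have hn : ‖p.1‖ ≠ 0 := norm_ne_zero_iff.2 h0
      set c : ℂ := ((‖p.1‖⁻¹ : ℝ) : ℂ) with hc
      have hq : c • p ∈ minimalGraph s := (minimalGraph s).smul_mem c hp
      rw [← minimalOperator_graph] at hq
      obtain ⟨y, hy1, hy2⟩ := (LinearPMap.mem_graph_iff _).1 hq
      have hcn : ‖c‖ = ‖p.1‖⁻¹ := by simp [hc]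
      have hy3 : ‖(y : L2HalfLine)‖ = 1 := by
        rw [hy1, Prod.smul_fst, norm_smul, hcn, inv_mul_cancel₀ hn]
      obtain ⟨r, hr, hw⟩ := mem_sector_zero_iff.1 (h y hy3)
      refine ⟨‖p.1‖ ^ 2 * r, by positivity, ?_⟩
      rw [hy1, hy2, Prod.smul_fst, Prod.smul_snd, inner_smul_left, inner_smul_right, hc,
        Complex.conj_ofReal] at hw
      have hn' : (‖p.1‖ : ℂ) ≠ 0 := by exact_mod_cast hn
      push_cast at hw ⊢
      field_simp at hw
      rw [hw]; ring
  · have hmem : ((y : L2HalfLine), minimalOperator s y) ∈ minimalGraph s := by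
      rw [← minimalOperator_graph]
      exact (minimalOperator s).mem_graph y
    obtain ⟨r, hr, hw⟩ := h _ hmem
    refine mem_sector_zero_iff.2 ⟨r, hr, ?_⟩
    rw [hw]
    simp [hy]

theorem memLp_halfLine_of_bound {f : ℝ → ℂ} {N : ℝ} {C : ℝ}
    (hm : AEStronglyMeasurable f halfLine) (hb : ∀ᵐ x ∂halfLine, ‖f x‖ ≤ C)
    (h0 : ∀ᵐ x ∂halfLine, N < x → f x = 0) : MemLp f 2 halfLine := by
  have h1 : f =ᵐ[halfLine] (Iic N).indicator f := by
    filter_upwards [h0] with x hx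
    by_cases hxN : x ∈ Iic N
    · rw [indicator_of_mem hxN]
    · rw [indicator_of_notMem hxN, hx (not_le.1 hxN)]
  refine (memLp_congr_ae h1).2 ((memLp_indicator_iff_restrict measurableSet_Iic).2 ?_)
  have : IsFiniteMeasure (halfLine.restrict (Iic N)) := by
    rw [Measure.restrict_restrict measurableSet_Iic, inter_comm, Ici_inter_Iic]
    infer_instance
  exact MemLp.of_bound hm.restrict C (ae_restrict_of_ae hb)

theorem exists_mem_minimalGraph {s Y Y' Z Z' v : ℝ → ℂ} {N : ℝ} (hY : HasACDeriv Y Y')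
    (hZ : HasACDeriv Z Z') (hYZ : ∀ᵐ x ∂halfLine, Y' x = s x * Y x + Z x)
    (hv : ∀ᵐ x ∂halfLine, v x = -Z' x - s x * Z x - s x ^ 2 * Y x) (hv2 : MemLp v 2 halfLine)
    (hN : 0 ≤ N) (hYN : ∀ x, N < x → Y x = 0) (hY0 : Y 0 = 0) (hZ0 : Z 0 = 0) :
    ∃ p ∈ minimalGraph s, p.1 =ᵐ[halfLine] Y ∧ p.2 =ᵐ[halfLine] v := by
  have hY2 : MemLp Y 2 halfLine := by
    obtain ⟨C, hC⟩ := isCompact_Icc.exists_bound_of_continuousOn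
      (hY.continuousOn.mono (Icc_subset_Ici_self : Icc 0 N ⊆ _))
    have hC0 : 0 ≤ C := (norm_nonneg _).trans (hC 0 ⟨le_rfl, hN⟩)
    refine memLp_halfLine_of_bound (C := C) (N := N)
      (hY.continuousOn.aestronglyMeasurable measurableSet_Ici) ?_
      (Filter.Eventually.of_forall hYN)
    filter_upwards [ae_pos_halfLine] with x hx
    by_cases hxN : x ≤ N
    · exact hC x ⟨hx.le, hxN⟩
    · rw [hYN x (not_le.1 hxN), norm_zero]; exact hC0
  refine ⟨(hY2.toLp Y, hv2.toLp v), ⟨Y, Z, ⟨⟨hY2.coeFn_toLp, hY.ac, hZ.ac, ?_, ?_⟩, hY0, hZ0,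
    ⟨N, fun x hx _ => hYN x hx⟩⟩⟩, hY2.coeFn_toLp, hv2.coeFn_toLp⟩
  · filter_upwards [hYZ, hY.deriv] with x h1 h2
    rw [quasiDeriv, h2.deriv, h1]; ring
  · filter_upwards [hv, hZ.deriv, hv2.coeFn_toLp] with x h1 h2 h3
    rw [h3, diffExpr, h2.deriv, h1]

/-- Variation of constants: for `y = ug` the quasi-derivative is `wg + Gh`, and in `l(y)` everything
cancels except `-G'h`. The identity `h = 1/u` is needed only where `G` is nonzero, so `u` may vanish
elsewhere. The boundary conditions at `0` and `N` allow extension by zero. -/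
theorem QuasiSolution.exists_mem_minimalGraph {s u w g G G' h h' : ℝ → ℂ} {N : ℝ}
    (hu : QuasiSolution s u w) (hg : HasACDeriv g (fun x => G x * h x ^ 2))
    (hG : HasACDeriv G G') (hh : HasACDeriv h h') (hG' : ContinuousOn G' (Ici 0))
    (hrel : ∀ᵐ x ∂halfLine, G x ≠ 0 →
      u x * h x = 1 ∧ h' x = -(s x * u x + w x) * h x ^ 2)
    (hN : 0 ≤ N) (hg0 : g 0 = 0) (hG0 : G 0 = 0) (hgN : g N = 0) (hGN : G N = 0) :
    ∃ p ∈ minimalGraph s, p.1 =ᵐ[halfLine] (Iic N).indicator (fun x => u x * g x) ∧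
      p.2 =ᵐ[halfLine] (Iic N).indicator (fun x => -(G' x * h x)) := by
  have hY := (hu.fst.mul hg).indicator_Iic hN (by simp [hgN])
  have hZ := ((hu.snd.mul hg).add (hG.mul hh)).indicator_Iic hN (by simp [hgN, hGN])
  have hcont : ContinuousOn (fun x => -(G' x * h x)) (Ici 0) := (hG'.mul hh.continuousOn).neg
  refine _root_.exists_mem_minimalGraph hY hZ ?_ ?_ ?_ hN (fun x hx => ?_) ?_ ?_
  · filter_upwards [hrel] with x hx
    by_cases hxN : x ∈ Iic N
    · simp only [indicator_of_mem hxN]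
      by_cases h0 : G x = 0
      · simp only [h0]; ring
      · linear_combination (G x * h x) * (hx h0).1
    · simp only [indicator_of_notMem hxN]; ring
  · filter_upwards [hrel] with x hx
    by_cases hxN : x ∈ Iic N
    · simp only [indicator_of_mem hxN]
      by_cases h0 : G x = 0
      · simp only [h0]; ring
      · linear_combination G x * (hx h0).2 - (s x * G x * h x) * (hx h0).1
    · simp only [indicator_of_notMem hxN]; ring
  · obtain ⟨C, hC⟩ := isCompact_Icc.exists_bound_of_continuousOn
      (hcont.mono (Icc_subset_Ici_self : Icc 0 N ⊆ _))
    have hC0 : 0 ≤ C := (norm_nonneg _).trans (hC 0 ⟨le_rfl, hN⟩)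
    refine memLp_halfLine_of_bound (C := C) (N := N)
      ((hcont.aestronglyMeasurable measurableSet_Ici).indicator measurableSet_Iic) ?_
      (Filter.Eventually.of_forall fun x hx => indicator_of_notMem (s := Iic N) (not_le.2 hx) _)
    filter_upwards [ae_pos_halfLine] with x hx
    by_cases hxN : x ∈ Iic N
    · rw [indicator_of_mem hxN]; exact hC x ⟨hx.le, hxN⟩
    · rw [indicator_of_notMem hxN, norm_zero]; exact hC0
  · exact indicator_of_notMem (s := Iic N) (not_le.2 hx) _
  · rw [indicator_of_mem (show (0 : ℝ) ∈ Iic N from hN), hg0, mul_zero]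
  · rw [indicator_of_mem (show (0 : ℝ) ∈ Iic N from hN), hg0, hG0]; ring

theorem MaximalPair.hasACDeriv_fst {s y z : ℝ → ℂ} {u v : L2HalfLine}
    (h : MaximalPair s u v y z) : HasACDeriv y (fun x => s x * y x + z x) :=
  h.ac.hasACDeriv.congr_deriv (by
    filter_upwards [h.quasi_eq] with x hx
    rw [hx, quasiDeriv]; ring)

theorem MaximalPair.hasACDeriv_snd {s y z : ℝ → ℂ} {u v : L2HalfLine}
    (h : MaximalPair s u v y z) :
    HasACDeriv z (fun x => -v x - s x * z x - s x ^ 2 * y x) :=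
  h.quasi_ac.hasACDeriv.congr_deriv (by
    filter_upwards [h.expr_eq] with x hx
    rw [hx, diffExpr]; ring)

theorem HasACDeriv.ofReal_mul (b : ℂ) : HasACDeriv (fun x => b * x) (fun _ => b) := by
  refine HasACDeriv.of_hasDerivAt (fun x => ?_) continuous_const
  simpa using (hasDerivAt_id x).ofReal_comp.const_mul b

/-- Adding `c + β x` to the generalized antiderivative adds `β` to the operator. -/
theorem minimalGraph_shift {s σ : ℝ → ℂ} {c β : ℂ}
    (h : ∀ᵐ x ∂halfLine, s x = σ x + (c + β * x)) {p : L2HalfLine × L2HalfLine}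
    (hp : p ∈ minimalGraph σ) : (p.1, p.2 + β • p.1) ∈ minimalGraph s := by
  obtain ⟨y, z, hyz⟩ := hp
  have hy := hyz.hasACDeriv_fst
  have hz := hyz.hasACDeriv_snd
  have hz' := hz.sub (((HasACDeriv.const c).add (HasACDeriv.ofReal_mul β)).mul hy)
  refine ⟨y, _, ⟨⟨hyz.rep, hyz.ac, hz'.ac, ?_, ?_⟩, hyz.init, ?_, hyz.compact_supp⟩⟩
  · filter_upwards [hy.deriv, h] with x h1 h2
    rw [quasiDeriv, h1.deriv, h2]; ring
  · filter_upwards [hz'.deriv, h, Lp.coeFn_add p.2 (β • p.1), Lp.coeFn_smul β p.1, hyz.rep]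
      with x h1 h2 h3 h4 h5
    simp only [h3, Pi.add_apply, h4, Pi.smul_apply, h5, smul_eq_mul]
    rw [diffExpr, h1.deriv, h2]; ring
  · simp [hyz.init, hyz.quasi_init]

/-! ### The representation implies semi-boundedness -/

theorem MemL2Loc.hasACDeriv_integral_sq {γ : ℝ → ℝ} (hγ : MemL2Loc γ) :
    HasACDeriv (fun x => ((∫ t in (0 : ℝ)..x, γ t ^ 2 : ℝ) : ℂ)) (fun x => (γ x : ℂ) ^ 2) := by
  have h1 : ∀ b, 0 ≤ b → IntervalIntegrable (fun x => (γ x : ℂ) ^ 2) volume 0 b :=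
    MemL2Loc.intervalIntegrable_sq fun b => (hγ b).ofReal
  refine (HasACDeriv.integral h1).congr (fun x _ => ?_) (Filter.Eventually.of_forall fun _ => rfl)
  have := RCLike.intervalIntegral_ofReal (𝕜 := ℂ) (a := 0) (b := x) (μ := volume)
    (f := fun t => γ t ^ 2)
  simp only [RCLike.ofReal_eq_complex_ofReal] at this
  rw [← this]
  simp

/-- Since `γ` is real, `(ȳ)' = γȳ + k̄`. Since `τ' = b + γ²`, the terms in `γ` cancel in `(ȳk)' =
|k|² + b|y|² - ȳ l(y)`. The constant `C` may be complex because it is absorbed into `k`. The lower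
bound is `b` itself. -/
theorem isSemibounded_of_representation {s : ℝ → ℂ} {γ : ℝ → ℝ} {b : ℝ} {C : ℂ}
    (hγ : MemL2Loc γ)
    (h : ∀ᵐ x ∂halfLine,
      s x = (b : ℂ) * x + γ x + ((∫ t in (0 : ℝ)..x, γ t ^ 2 : ℝ) : ℂ) + C) :
    IsSemibounded (minimalOperator s) := by
  refine (isSemibounded_minimalOperator_iff s).2 ⟨b, ?_⟩
  rintro p ⟨y, z, hyz⟩
  have hy := hyz.hasACDeriv_fst
  have hz := hyz.hasACDeriv_snd
  have hτ := ((HasACDeriv.ofReal_mul (b : ℂ)).add hγ.hasACDeriv_integral_sq).add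
    (HasACDeriv.const C)
  set τ : ℝ → ℂ := fun x => (b : ℂ) * x + ((∫ t in (0 : ℝ)..x, γ t ^ 2 : ℝ) : ℂ) + C with hτdef
  have hk := hz.add (hτ.mul hy)
  set k : ℝ → ℂ := fun x => z x + τ x * y x with hkdef
  have hky := (hk.mul hy.star).congr_deriv (g' := fun x =>
    ((starRingEnd ℂ) (k x) * k x + b * (starRingEnd ℂ (y x) * y x))
      - starRingEnd ℂ (y x) * p.2 x) (by
    filter_upwards [h] with x hx
    have hs : s x = γ x + τ x := by rw [hx, hτdef]; ring
    rw [hs, hkdef]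
    simp only [map_add, map_mul, Complex.conj_ofReal]
    ring)
  obtain ⟨B, hB⟩ := hyz.compact_supp
  -- The added `1` makes `N` strictly larger than `B`, so that `y` already vanishes at `N`.
  set N : ℝ := max B 0 + 1 with hNdef
  have hN0 : 0 ≤ N := by positivity
  have hyN : ∀ x, N ≤ x → y x = 0 := fun x hx => hB x
    (by have := le_max_left B 0; linarith) (hN0.trans hx)
  have hkc : ContinuousOn (fun x => starRingEnd ℂ (k x) * k x) (Ici 0) :=
    hk.star.continuousOn.mul hk.continuousOn
  have hyc : ContinuousOn (fun x => starRingEnd ℂ (y x) * y x) (Ici 0) :=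
    hy.star.continuousOn.mul hy.continuousOn
  have i1 := intervalIntegrable_of_continuousOn_Ici hkc N hN0
  have i2 := (intervalIntegrable_of_continuousOn_Ici hyc N hN0).const_mul (b : ℂ)
  have i3 : IntervalIntegrable (fun x => starRingEnd ℂ (y x) * p.2 x) volume 0 N :=
    ((i1.add i2).sub (hky.intervalIntegrable hN0)).congr
      (fun x _ => by simp)
  have e := hky.integral_eq hN0
  rw [intervalIntegral.integral_sub (i1.add i2) i3, intervalIntegral.integral_add i1 i2,
    intervalIntegral.integral_const_mul, hyN N le_rfl, hyz.init] at e
  simp only [map_zero, mul_zero, sub_zero] at e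
  have e1 : inner ℂ p.1 p.2 = ∫ x in (0 : ℝ)..N, starRingEnd ℂ (y x) * p.2 x := by
    rw [inner_L2HalfLine_eq hyz.rep (Filter.EventuallyEq.refl _ _), integral_halfLine_eq hN0]
    exact Filter.Eventually.of_forall fun x hx => by rw [hyN x hx.le]; simp
  have e2 : ((‖p.1‖ ^ 2 : ℝ) : ℂ) = ∫ x in (0 : ℝ)..N, starRingEnd ℂ (y x) * y x := by
    rw [ofReal_norm_sq_L2HalfLine_eq hyz.rep, integral_halfLine_eq hN0]
    exact Filter.Eventually.of_forall fun x hx => by rw [hyN x hx.le]; simp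
  have e3 : ((∫ x in (0 : ℝ)..N, Complex.normSq (k x) : ℝ) : ℂ)
      = ∫ x in (0 : ℝ)..N, starRingEnd ℂ (k x) * k x := by
    have := RCLike.intervalIntegral_ofReal (𝕜 := ℂ) (a := 0) (b := N) (μ := volume)
      (f := fun t => Complex.normSq (k t))
    simp only [RCLike.ofReal_eq_complex_ofReal] at this
    rw [← this]
    simp only [Complex.normSq_eq_conj_mul_self]
  refine ⟨∫ x in (0 : ℝ)..N, Complex.normSq (k x),
    intervalIntegral.integral_nonneg hN0 fun x _ => Complex.normSq_nonneg _, ?_⟩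
  rw [Complex.ofReal_add, Complex.ofReal_mul, e1, e2, e3]
  linear_combination -e

/-! ### A real form forces `Im s` to be constant -/

/-- Polarization: reality of the form at `p + q` and at `p + iq` gives the imaginary and the real
part of the identity. -/
theorem inner_symm_of_mem_minimalGraph {s : ℝ → ℂ}
    (h : ∀ p ∈ minimalGraph s, (inner ℂ p.1 p.2).im = 0) {p q : L2HalfLine × L2HalfLine}
    (hp : p ∈ minimalGraph s) (hq : q ∈ minimalGraph s) : inner ℂ p.1 q.2 = inner ℂ p.2 q.1 := by
  have h1 := h _ (add_mem hp hq)
  have h2 := h _ (add_mem hp ((minimalGraph s).smul_mem Complex.I hq))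
  have hp0 := h p hp
  have hq0 := h q hq
  simp only [Prod.fst_add, Prod.snd_add, inner_add_left, inner_add_right, Complex.add_im, Complex.add_re,
    Prod.smul_fst, Prod.smul_snd, inner_smul_left, inner_smul_right, Complex.conj_I,
    Complex.mul_im, Complex.mul_re, Complex.neg_re, Complex.neg_im, Complex.I_re, Complex.I_im]
    at h1 h2
  rw [← inner_conj_symm p.2 q.1]
  apply Complex.ext
  · rw [Complex.conj_re]; linarith
  · rw [Complex.conj_im]; linarith

/-- Two local constants agree where their intervals overlap in positive measure. The chosen constant
is therefore a locally constant function of the centre, hence constant on the connected set `(0,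
∞)`. -/
theorem exists_ae_eq_const_of_locally {f : ℝ → ℂ}
    (h : ∀ x, 0 < x → ∃ a b c, a < x ∧ x < b ∧ ∀ᵐ t ∂halfLine, t ∈ Ioo a b → f t = c) :
    ∃ c, ∀ᵐ t ∂halfLine, f t = c := by
  choose! a b c ha hb hc using h
  have hloc : ∀ x, 0 < x → ∀ y, 0 < y → y ∈ Ioo (a x) (b x) → c y = c x := by
    intro x hx y hy hyx
    have hU : IsOpen (Ioi (0 : ℝ) ∩ Ioo (a x) (b x) ∩ Ioo (a y) (b y)) :=
      (isOpen_Ioi.inter isOpen_Ioo).inter isOpen_Ioo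
    have hpos := hU.measure_pos volume ⟨y, ⟨⟨hy, hyx⟩, ha y hy, hb y hy⟩⟩
    obtain ⟨t, ht, h1, h2⟩ := ((frequently_ae_mem_iff.2 hpos.ne').and_eventually
      ((ae_of_ae_halfLine (hc x hx)).and (ae_of_ae_halfLine (hc y hy)))).exists
    rw [← h1 (le_of_lt ht.1.1) ht.1.2, h2 (le_of_lt ht.1.1) ht.2]
  have hder : ∀ x ∈ Ioi (0 : ℝ), HasDerivAt c 0 x := by
    intro x hx
    refine (hasDerivAt_const x (c x)).congr_of_eventuallyEq ?_
    filter_upwards [Ioi_mem_nhds hx, Ioo_mem_nhds (ha x hx) (hb x hx)] with y h1 h2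
      using hloc x hx y h1 h2
  have hconst : ∀ x ∈ Ioi (0 : ℝ), c x = c 1 := fun x hx =>
    isOpen_Ioi.is_const_of_deriv_eq_zero isPreconnected_Ioi
      (fun x hx => (hder x hx).differentiableAt.differentiableWithinAt)
      (fun x hx => (hder x hx).deriv) hx (mem_Ioi.2 one_pos)
  refine ⟨c 1, ?_⟩
  refine ae_halfLine_of_ae_Ioi ?_
  rw [ae_iff]
  refine measure_null_of_locally_null _ fun x hx => ?_
  simp only [Classical.not_imp, mem_ofPred_eq] at hx
  refine ⟨_, inter_mem_nhdsWithin _ (Ioo_mem_nhds (ha x hx.1) (hb x hx.1)), ?_⟩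
  have := ae_of_ae_halfLine (hc x hx.1)
  rw [ae_iff] at this
  refine measure_mono_null ?_ this
  rintro t ⟨ht1, ht2⟩
  simp only [Classical.not_imp, mem_ofPred_eq] at ht1 ⊢
  exact ⟨ht1.1.le, ht2, by rw [← hconst x hx.1] at ht1; exact ht1.2⟩

/-- Smooth functions with compact support in `(a, b)`. -/
structure IsTestOn (a b : ℝ) (G : ℝ → ℂ) : Prop where
  smooth : ContDiff ℝ ((⊤ : ℕ∞) : WithTop ℕ∞) G
  compact : HasCompactSupport G
  supp : tsupport G ⊆ Ioo a b

namespace IsTestOn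

variable {a b : ℝ} {G H F k : ℝ → ℂ}

theorem eq_zero (h : IsTestOn a b G) {x : ℝ} (hx : x ∉ Ioo a b) : G x = 0 :=
  image_eq_zero_of_notMem_tsupport fun h' => hx (h.supp h')

theorem deriv_eq_zero (h : IsTestOn a b G) {x : ℝ} (hx : x ∉ Ioo a b) : deriv G x = 0 := by
  have h1 : x ∉ tsupport G := fun h' => hx (h.supp h')
  have h2 : G =ᶠ[nhds x] fun _ => 0 := notMem_tsupport_iff_eventuallyEq.1 h1
  rw [h2.deriv_eq]; simp

theorem sub (hG : IsTestOn a b G) (hH : IsTestOn a b H) : IsTestOn a b (fun x => G x - H x) :=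
  ⟨hG.smooth.sub hH.smooth, hG.compact.sub hH.compact,
    (tsupport_sub G H).trans (union_subset hG.supp hH.supp)⟩

theorem mono {a' b' : ℝ} (hG : IsTestOn a b G) (h : Ioo a b ⊆ Ioo a' b') : IsTestOn a' b' G :=
  ⟨hG.smooth, hG.compact, hG.supp.trans h⟩

theorem mul_const (hG : IsTestOn a b G) (c : ℂ) : IsTestOn a b (fun x => G x * c) :=
  ⟨hG.smooth.mul contDiff_const, hG.compact.mul_right,
    (tsupport_mul_subset_left).trans hG.supp⟩

theorem ofReal {γ : ℝ → ℝ} (h1 : ContDiff ℝ ((⊤ : ℕ∞) : WithTop ℕ∞) γ) (h2 : HasCompactSupport γ)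
    (h3 : tsupport γ ⊆ Ioo a b) : IsTestOn a b (fun x => (γ x : ℂ)) := by
  refine ⟨Complex.ofRealCLM.contDiff.comp h1, h2.comp_left (g := fun x : ℝ => (x : ℂ)) (by simp),
    (closure_mono ?_).trans h3⟩
  intro x hx
  simpa using hx

theorem hasACDeriv (h : IsTestOn a b G) : HasACDeriv G (deriv G) :=
  HasACDeriv.of_hasDerivAt
    (fun x => ((h.smooth.differentiable (by simp)) x).hasDerivAt)
    (h.smooth.continuous_deriv (by simp))

theorem integrable (hG : IsTestOn a b G) (hF : IntegrableOn F (Ioo a b)) :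
    Integrable (fun x => G x * F x) := by
  have h1 : IntegrableOn (fun x => G x * F x) (Ioo a b) := by
    obtain ⟨C, hC⟩ := hG.compact.exists_bound_of_continuous hG.smooth.continuous
    exact Integrable.bdd_mul (c := C) hF hG.smooth.continuous.aestronglyMeasurable
      (Filter.Eventually.of_forall hC)
  refine (integrableOn_iff_integrable_of_support_subset fun x hx => ?_).1 h1
  by_contra hc
  exact hx (by simp [hG.eq_zero hc])

/-- Otherwise, after rescaling, `k` would annihilate every test function and vanish a.e. -/
theorem exists_integral_eq_one (hab : a < b) (hk : IntegrableOn k (Ioo a b))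
    (hk0 : ∀ x ∈ Ioo a b, k x ≠ 0) : ∃ G, IsTestOn a b G ∧ ∫ x, G x * k x = 1 := by
  by_contra! hc
  have h1 : ∀ᵐ x, x ∈ Ioo a b → k x = 0 := by
    refine isOpen_Ioo.ae_eq_zero_of_integral_contDiff_smul_eq_zero hk.locallyIntegrableOn ?_
    intro γ h1 h2 h3
    by_contra hne
    refine hc _ ((ofReal h1 h2 h3).mul_const (∫ x, γ x • k x)⁻¹) ?_
    calc _ = ∫ x, (γ x • k x) * (∫ x, γ x • k x)⁻¹ := by
          refine integral_congr_ae (Filter.Eventually.of_forall fun x => ?_)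
          simp only [Complex.real_smul]
          ring
      _ = 1 := by rw [integral_mul_const, mul_inv_cancel₀ hne]
  obtain ⟨t, ht, h2⟩ := ((frequently_ae_mem_iff.2 (isOpen_Ioo.measure_pos volume
    (nonempty_Ioo.2 hab)).ne').and_eventually h1).exists
  exact hk0 t ht (h2 ht)

/-- A du Bois-Reymond lemma. -/
theorem exists_ae_eq_const_mul (hab : a < b) (hk : IntegrableOn k (Ioo a b))
    (hk0 : ∀ x ∈ Ioo a b, k x ≠ 0) (hF : IntegrableOn F (Ioo a b))
    (h : ∀ G, IsTestOn a b G → ∫ x, G x * k x = 0 → ∫ x, G x * F x = 0) :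
    ∃ κ, ∀ᵐ x, x ∈ Ioo a b → F x = κ * k x := by
  obtain ⟨G₀, hG₀, h₀⟩ := exists_integral_eq_one hab hk hk0
  set κ := ∫ x, G₀ x * F x
  refine ⟨κ, ?_⟩
  have h1 : ∀ᵐ x, x ∈ Ioo a b → F x - κ * k x = 0 := by
    refine isOpen_Ioo.ae_eq_zero_of_integral_contDiff_smul_eq_zero
      (hF.sub (hk.const_mul κ)).locallyIntegrableOn ?_
    intro γ h1 h2 h3
    have hγ := ofReal h1 h2 h3
    set c := ∫ x, (γ x : ℂ) * k x with hc
    -- Subtracting a multiple of the normalized `G₀` makes an arbitrary test function orthogonal to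
    -- `k`; the price is the multiplier `κ = ∫G₀F`.
    have hT := hγ.sub (hG₀.mul_const c)
    have e1 := h _ hT (by
      simp only [sub_mul, mul_assoc]
      simp only [mul_comm c]
      simp only [← mul_assoc]
      rw [integral_sub (hγ.integrable hk) ((hG₀.integrable hk).mul_const c), integral_mul_const, h₀,
        ← hc]
      ring)
    simp only [sub_mul, mul_assoc, mul_comm c] at e1
    simp only [← mul_assoc] at e1
    rw [integral_sub (hγ.integrable hF) ((hG₀.integrable hF).mul_const c),
      integral_mul_const] at e1
    simp only [Complex.real_smul, mul_sub]
    calc _ = ∫ x, ((γ x : ℂ) * F x - (γ x * k x) * κ) := by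
          refine integral_congr_ae (Filter.Eventually.of_forall fun x => ?_)
          simp only
          ring
      _ = 0 := by
          rw [integral_sub (hγ.integrable hF) ((hγ.integrable hk).mul_const κ),
            integral_mul_const, ← hc, mul_comm c, e1]
  filter_upwards [h1] with x hx hxm using sub_eq_zero.1 (hx hxm)

end IsTestOn

/-- Freezing an absolutely continuous function outside an interval. -/
theorem HasACDeriv.exists_clamp {f f' : ℝ → ℂ} (hf : HasACDeriv f f') {A B : ℝ} (hA : 0 ≤ A)
    (hAB : A ≤ B) : ∃ F', HasACDeriv (fun x => f (max A (min x B))) F' ∧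
      ∀ x ∈ Ioo A B, F' x = f' x := by
  have hB := hA.trans hAB
  -- Each cut is made at a zero: first `f - f B` at `B`, then, after passing to `f - f A`, the part
  -- up to `A` is removed.
  have h1 := (hf.sub (HasACDeriv.const (f B))).indicator_Iic hB (sub_self _)
  have h2 := h1.add (HasACDeriv.const (f B - f A))
  have h3 := h2.indicator_Iic hA (by
    rw [indicator_of_mem (show A ∈ Iic B from hAB)]; ring)
  refine ⟨_, ((h2.sub h3).add (HasACDeriv.const (f A))).congr (fun x hx => ?_)
    (Filter.Eventually.of_forall fun x => rfl), fun x hx => ?_⟩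
  · by_cases hxA : x ∈ Iic A
    · rw [indicator_of_mem hxA, min_eq_left (le_trans hxA hAB), max_eq_left hxA]; ring
    · rw [indicator_of_notMem hxA]
      have hxA' : A ≤ x := le_of_lt (not_le.1 hxA)
      by_cases hxB : x ∈ Iic B
      · rw [indicator_of_mem hxB, min_eq_left hxB, max_eq_right hxA']; ring
      · rw [indicator_of_notMem hxB, min_eq_right (le_of_lt (not_le.1 hxB)), max_eq_right hAB]; ring
  · rw [indicator_of_notMem (s := Iic A) (not_le.2 hx.1), indicator_of_mem (s := Iic B) hx.2.le]
    ring

theorem intervalIntegral_eq_zero_of_support {f : ℝ → ℂ} {a b x : ℝ} (hx : 0 ≤ x) (hxa : x ≤ a)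
    (hf : ∀ t, t ∉ Ioo a b → f t = 0) : ∫ t in (0 : ℝ)..x, f t = 0 :=
  intervalIntegral.integral_zero_ae (Filter.Eventually.of_forall fun t ht => by
    rw [uIoc_of_le hx] at ht
    exact hf t fun h => absurd h.1 (not_lt.2 (ht.2.trans hxa)))

theorem intervalIntegral_eq_integral_of_support {f : ℝ → ℂ} {a b x : ℝ} (ha : 0 ≤ a) (hx : 0 ≤ x)
    (hxb : b ≤ x) (hf : ∀ t, t ∉ Ioo a b → f t = 0) : ∫ t in (0 : ℝ)..x, f t = ∫ t, f t := by
  rw [intervalIntegral.integral_of_le hx]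
  refine setIntegral_eq_integral_of_forall_compl_eq_zero fun t ht => hf t fun h => ht ?_
  exact ⟨ha.trans_lt h.1, h.2.le.trans hxb⟩

theorem QuasiSolution.wronskian {s u₁ w₁ u₂ w₂ : ℝ → ℂ} (h₁ : QuasiSolution s u₁ w₁)
    (h₂ : QuasiSolution s u₂ w₂) {x : ℝ} (hx : 0 ≤ x) :
    u₁ x * w₂ x - w₁ x * u₂ x = u₁ 0 * w₂ 0 - w₁ 0 * u₂ 0 :=
  ((h₁.fst.mul h₂.snd).sub (h₁.snd.mul h₂.fst)).eq_of_ae_zero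
    (Filter.Eventually.of_forall fun x => by ring) hx

/-- Two solutions with Wronskian `1` have no common zero. -/
theorem MemL2Loc.exists_quasiSolution_ne_zero {s : ℝ → ℂ} (hs : MemL2Loc s) {x : ℝ}
    (hx : 0 ≤ x) : ∃ u w, QuasiSolution s u w ∧ u x ≠ 0 := by
  obtain ⟨u₁, w₁, h₁, hu₁, hw₁⟩ := hs.exists_quasiSolution 1 0
  obtain ⟨u₂, w₂, h₂, hu₂, hw₂⟩ := hs.exists_quasiSolution 0 1
  by_cases h : u₁ x = 0
  · refine ⟨u₂, w₂, h₂, fun h' => ?_⟩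
    have := h₁.wronskian h₂ hx
    rw [h, h', hu₁, hw₁, hu₂, hw₂] at this
    simp at this
  · exact ⟨u₁, w₁, h₁, h⟩

/-- If the minimal operator is symmetric, then `(h ū)'` is orthogonal to the test functions
orthogonal to `h²`, where `h = 1 / u` near the interval. -/
theorem QuasiSolution.integral_test_eq_zero {s u w h h' : ℝ → ℂ} {A a b B : ℝ}
    (hu : QuasiSolution s u w) (hh : HasACDeriv h h') (hA : 0 ≤ A) (hAa : A < a) (hab : a < b)
    (hbB : b < B) (hh0 : ∀ x ∈ Ioo A B, h x ≠ 0) (huh : ∀ x ∈ Ioo A B, u x * h x = 1)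
    (hh' : ∀ᵐ x ∂halfLine, x ∈ Ioo A B → h' x = -(s x * u x + w x) * h x ^ 2)
    (hsym : ∀ p ∈ minimalGraph s, ∀ q ∈ minimalGraph s, inner ℂ p.1 q.2 = inner ℂ p.2 q.1)
    {G : ℝ → ℂ} (hG : IsTestOn a b G) (hG0 : ∫ x, G x * h x ^ 2 = 0) :
    ∫ x in (0 : ℝ)..B, deriv G x * (h x * starRingEnd ℂ (u x)) = 0 := by
  have ha : 0 ≤ a := hA.trans hAa.le
  have hb : 0 ≤ b := ha.trans hab.le
  have hB : 0 ≤ B := hb.trans hbB.le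
  have hcont : ContinuousOn (fun x => h x ^ 2) (Ici 0) := hh.continuousOn.pow 2
  have hint : ∀ c d, 0 ≤ c → IntegrableOn (fun x => h x ^ 2) (Ioo c d) := fun c d hc =>
    ((hcont.mono (fun x hx => hc.trans hx.1 : Icc c d ⊆ Ici 0)).integrableOn_Icc).mono_set
      Ioo_subset_Icc_self
  -- The primitive of `(Gl - Gr)h²` climbs to `1` left of `a`, stays there on `(a, b)`, and returns
  -- to `0` right of `b`. The resulting `q` equals `u` on the support of the test function `G`.
  obtain ⟨Gl, hGl, hGl1⟩ := IsTestOn.exists_integral_eq_one hAa (hint A a hA)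
    fun x hx => pow_ne_zero 2 (hh0 x ⟨hx.1, hx.2.trans (hab.trans hbB)⟩)
  obtain ⟨Gr, hGr, hGr1⟩ := IsTestOn.exists_integral_eq_one hbB (hint b B hb)
    fun x hx => pow_ne_zero 2 (hh0 x ⟨hAa.trans (hab.trans hx.1), hx.2⟩)
  have hGA := hG.mono (Ioo_subset_Ioo hAa.le hbB.le)
  have hGl' := hGl.mono (Ioo_subset_Ioo le_rfl (hab.trans hbB).le)
  have hGr' := hGr.mono (Ioo_subset_Ioo (hAa.trans hab).le le_rfl)
  have hz : ∀ {c d : ℝ} {G : ℝ → ℂ}, IsTestOn c d G → ∀ t, t ∉ Ioo c d → G t * h t ^ 2 = 0 :=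
    fun hG t ht => by rw [hG.eq_zero ht, zero_mul]
  have hprim : ∀ {G : ℝ → ℂ}, IsTestOn A B G →
      HasACDeriv (fun x => ∫ t in (0 : ℝ)..x, G t * h t ^ 2) (fun x => G x * h x ^ 2) := fun hG =>
    hasACDeriv_integral_mul
      (intervalIntegrable_of_continuousOn_Ici hG.smooth.continuous.continuousOn) hcont
  have hmem : ∀ {G : ℝ → ℂ}, IsTestOn A B G → ∫ x, G x * h x ^ 2 = 0 →
      ∃ p ∈ minimalGraph s, p.1 =ᵐ[halfLine] (Iic B).indicator
          (fun x => u x * ∫ t in (0 : ℝ)..x, G t * h t ^ 2) ∧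
        p.2 =ᵐ[halfLine] (Iic B).indicator (fun x => -(deriv G x * h x)) := by
    intro G hG hG0
    refine hu.exists_mem_minimalGraph (hprim hG) hG.hasACDeriv hh
      (hG.smooth.continuous_deriv (by simp)).continuousOn ?_ hB (by simp)
      (hG.eq_zero fun h => absurd h.1 (not_lt.2 hA)) ?_ (hG.eq_zero fun h => lt_irrefl _ h.2)
    · filter_upwards [hh'] with x hx hGx
      have hxm : x ∈ Ioo A B := by
        by_contra hc
        exact hGx (hG.eq_zero hc)
      exact ⟨huh x hxm, hx hxm⟩
    · rw [intervalIntegral_eq_integral_of_support hA hB le_rfl (hz hG), hG0]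
  obtain ⟨p, hp, hp1, hp2⟩ := hmem hGA hG0
  obtain ⟨q, hq, hq1, hq2⟩ := hmem (hGl'.sub hGr') (by
    simp only [sub_mul]
    rw [integral_sub (hGl.integrable (hint A a hA)) (hGr.integrable (hint b B hb)), hGl1, hGr1,
      sub_self])
  have hplateau : ∀ x ∈ Ioo a b, (∫ t in (0 : ℝ)..x, (Gl t - Gr t) * h t ^ 2) = 1 := by
    intro x hx
    have hx0 : 0 ≤ x := ha.trans hx.1.le
    simp only [sub_mul]
    rw [intervalIntegral.integral_sub ((hprim hGl').intervalIntegrable hx0)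
      ((hprim hGr').intervalIntegrable hx0),
      intervalIntegral_eq_integral_of_support hA hx0 hx.1.le (hz hGl),
      intervalIntegral_eq_zero_of_support hx0 hx.2.le (hz hGr), hGl1, sub_zero]
  have hvan : ∀ x, 0 ≤ x → x ∉ Ioo a b → (∫ t in (0 : ℝ)..x, G t * h t ^ 2) = 0 := by
    intro x hx0 hx
    by_cases hxa : x ≤ a
    · exact intervalIntegral_eq_zero_of_support hx0 hxa (hz hG)
    · have : b ≤ x := by
        by_contra hc
        exact hx ⟨not_le.1 hxa, not_le.1 hc⟩
      rw [intervalIntegral_eq_integral_of_support ha hx0 this (hz hG), hG0]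
  have e := hsym p hp q hq
  rw [inner_L2HalfLine_eq hp1 hq2, inner_L2HalfLine_eq hp2 hq1] at e
  -- On `(a, b)` the function `q` solves the homogeneous equation, and off `(a, b)` the function `p`
  -- vanishes, so this side of the symmetry relation is zero.
  have e1 : ∫ x, starRingEnd ℂ ((Iic B).indicator
      (fun x => u x * ∫ t in (0 : ℝ)..x, G t * h t ^ 2) x) *
      (Iic B).indicator (fun x => -(deriv (fun x => Gl x - Gr x) x * h x)) x ∂halfLine = 0 := by
    refine integral_eq_zero_of_ae ?_
    filter_upwards [ae_pos_halfLine] with x hx0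
    by_cases hx : x ∈ Ioo a b
    · have : deriv (fun x => Gl x - Gr x) x = 0 := by
        have h1 : (fun x => Gl x - Gr x) =ᶠ[nhds x] fun _ => 0 := by
          filter_upwards [Ioo_mem_nhds hx.1 hx.2] with t ht
          rw [hGl.eq_zero fun h => absurd h.2 (not_lt.2 ht.1.le),
            hGr.eq_zero fun h => absurd h.1 (not_lt.2 ht.2.le), sub_zero]
        rw [h1.deriv_eq]; simp
      simp [indicator, this]
    · simp [indicator, hvan x hx0.le hx]
  rw [e1] at e
  have e2 : ∫ x, starRingEnd ℂ ((Iic B).indicator (fun x => -(deriv G x * h x)) x) *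
      (Iic B).indicator (fun x => u x * ∫ t in (0 : ℝ)..x, (Gl t - Gr t) * h t ^ 2) x ∂halfLine
      = ∫ x, -starRingEnd ℂ (deriv G x * (h x * starRingEnd ℂ (u x))) ∂halfLine := by
    refine integral_congr_ae (Filter.Eventually.of_forall fun x => ?_)
    by_cases hx : x ∈ Ioo a b
    · have hxB : x ∈ Iic B := hx.2.le.trans hbB.le
      simp only [indicator_of_mem hxB, hplateau x hx, map_neg, map_mul, Complex.conj_conj]
      ring
    · simp [indicator, hG.deriv_eq_zero hx]
  rw [e2, integral_neg, integral_conj, eq_comm, neg_eq_zero, map_eq_zero,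
    integral_halfLine_eq hB] at e
  · exact e
  · refine Filter.Eventually.of_forall fun x hx => ?_
    rw [hG.deriv_eq_zero fun h => absurd h.2 (not_lt.2 (hbB.le.trans hx.le)), zero_mul]

/-- Integrating by parts in the orthogonality relation and applying du Bois-Reymond gives `(hū)' =
κh²`. Multiplied by `u²` this reads `κ = (s̄ - s)|u|² + uw̄ - wū`. So `s̄ - s` has an absolutely
continuous version, and the differential equations then make its derivative zero. -/
theorem exists_ae_conj_sub_eq_const_locally {s : ℝ → ℂ} (hs : MemL2Loc s)
    (hsym : ∀ p ∈ minimalGraph s, ∀ q ∈ minimalGraph s, inner ℂ p.1 q.2 = inner ℂ p.2 q.1)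
    {x₀ : ℝ} (hx₀ : 0 < x₀) : ∃ a b c, a < x₀ ∧ x₀ < b ∧
      ∀ᵐ t ∂halfLine, t ∈ Ioo a b → starRingEnd ℂ (s t) - s t = c := by
  obtain ⟨u, w, hu, hux⟩ := hs.exists_quasiSolution_ne_zero hx₀.le
  have hnhds : ∀ᶠ x in nhds x₀, u x ≠ 0 :=
    ((hu.fst.continuousOn.continuousAt (Ici_mem_nhds hx₀)).eventually_ne hux)
  obtain ⟨ε, hε, hball⟩ := Metric.eventually_nhds_iff.1 hnhds
  set δ := min (ε / 2) (x₀ / 2) with hδ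
  have hδ0 : 0 < δ := by positivity
  have hδε : δ < ε := (min_le_left _ _).trans_lt (by linarith)
  have hδx : δ ≤ x₀ / 2 := min_le_right _ _
  set A := x₀ - δ with hAdef
  set B := x₀ + δ with hBdef
  have hA : 0 ≤ A := by linarith
  have hAB : A ≤ B := by linarith
  have hune : ∀ x ∈ Icc A B, u x ≠ 0 := fun x hx => hball (by
    rw [Real.dist_eq, abs_lt]
    constructor <;> linarith [hx.1, hx.2])
  -- Clamping makes the reciprocal of `u` defined and absolutely continuous on the whole half-line,
  -- although `u` may have zeros outside `[A, B]`.
  obtain ⟨F', hF, hF'⟩ := hu.fst.exists_clamp hA hAB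
  have hFne : ∀ x, u (max A (min x B)) ≠ 0 := fun x =>
    hune _ ⟨le_max_left _ _, max_le hAB (min_le_right _ _)⟩
  have hFeq : ∀ x ∈ Ioo A B, u (max A (min x B)) = u x := fun x hx => by
    rw [min_eq_left hx.2.le, max_eq_right hx.1.le]
  have hh := hF.inv fun x _ => hFne x
  set h : ℝ → ℂ := fun x => (u (max A (min x B)))⁻¹ with hhdef
  have huh : ∀ x ∈ Ioo A B, u x * h x = 1 := fun x hx => by
    rw [hhdef]
    simp only [hFeq x hx]
    exact mul_inv_cancel₀ (hune x ⟨hx.1.le, hx.2.le⟩)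
  have hh0 : ∀ x, h x ≠ 0 := fun x => inv_ne_zero (hFne x)
  set h' : ℝ → ℂ := fun x => -F' x / u (max A (min x B)) ^ 2 with hh'def
  have hh' : ∀ x ∈ Ioo A B, h' x = -(s x * u x + w x) * h x ^ 2 := fun x hx => by
    rw [hh'def, hhdef]
    simp only [hF' x hx, inv_pow]
    rw [div_eq_mul_inv]
  set a := x₀ - δ / 2 with hadef
  set b := x₀ + δ / 2 with hbdef
  have hAa : A < a := by linarith
  have hab : a < b := by linarith
  have hbB : b < B := by linarith
  have ha : 0 ≤ a := hA.trans hAa.le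
  have hB : 0 ≤ B := hA.trans hAB
  have hsub : ∀ x ∈ Ioo a b, x ∈ Ioo A B := fun x hx => ⟨hAa.trans hx.1, hx.2.trans hbB⟩
  have hq := hh.mul hu.fst.star
  set q' : ℝ → ℂ := fun x => h' x * starRingEnd ℂ (u x) +
    h x * starRingEnd ℂ (s x * u x + w x) with hq'def
  have hcont : ContinuousOn (fun x => h x ^ 2) (Ici 0) := hh.continuousOn.pow 2
  have hk : IntegrableOn (fun x => h x ^ 2) (Ioo a b) :=
    ((hcont.mono (fun x hx => ha.trans hx.1 : Icc a b ⊆ Ici 0)).integrableOn_Icc).mono_set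
      Ioo_subset_Icc_self
  have hq'i : IntegrableOn q' (Ioo a b) :=
    ((intervalIntegrable_iff_integrableOn_Icc_of_le hB).1 (hq.intervalIntegrable hB)).mono_set
      fun x hx => ⟨ha.trans hx.1.le, hx.2.le.trans hbB.le⟩
  obtain ⟨κ, hκ⟩ := IsTestOn.exists_ae_eq_const_mul hab hk (fun x _ => pow_ne_zero 2 (hh0 x)) hq'i
    (by
      intro G hG hG0
      have h1 := hu.integral_test_eq_zero hh hA hAa hab hbB (fun x _ => hh0 x) huh
        (Filter.Eventually.of_forall hh') hsym hG hG0
      have hGq := hG.hasACDeriv.mul hq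
      have h2 := hGq.integral_eq hB
      have i1 : IntervalIntegrable (fun x => deriv G x * (h x * starRingEnd ℂ (u x)))
          volume 0 B := intervalIntegrable_of_continuousOn_Ici
        ((hG.smooth.continuous_deriv (by simp)).continuousOn.mul hq.continuousOn) B hB
      have i2 : IntervalIntegrable (fun x => G x * q' x) volume 0 B :=
        ((hGq.intervalIntegrable hB).sub i1).congr fun x _ => by simp [q']
      rw [intervalIntegral.integral_add i1 i2, h1, zero_add,
        hG.eq_zero (x := B) fun h => absurd h.2 (not_lt.2 hbB.le),
        hG.eq_zero (x := 0) fun h => absurd h.1 (not_lt.2 ha),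
        intervalIntegral_eq_integral_of_support ha hB hbB.le
          (fun t ht => by rw [hG.eq_zero ht, zero_mul])] at h2
      simpa using h2)
  have hd : ∀ᵐ x ∂halfLine, x ∈ Ioo a b → κ = (starRingEnd ℂ (s x) - s x) *
      (u x * starRingEnd ℂ (u x)) + u x * starRingEnd ℂ (w x) - w x * starRingEnd ℂ (u x) := by
    filter_upwards [ae_restrict_of_ae hκ] with x hx hxm
    have h1 := hx hxm
    rw [hq'def] at h1
    simp only [hh' x (hsub x hxm), map_add, map_mul] at h1
    have h2 : h x = (u x)⁻¹ := by rw [hhdef]; simp only [hFeq x (hsub x hxm)]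
    have h3 : u x ≠ 0 := hune x ⟨(hsub x hxm).1.le, (hsub x hxm).2.le⟩
    rw [h2] at h1
    field_simp at h1
    linear_combination -h1
  have hD := (((HasACDeriv.const κ).sub (hu.fst.mul hu.snd.star)).add
    (hu.snd.mul hu.fst.star)).mul (hh.mul hh.star)
  have hDeq : ∀ᵐ x ∂halfLine, x ∈ Ioo a b →
      (κ - u x * starRingEnd ℂ (w x) + w x * starRingEnd ℂ (u x)) *
        (h x * starRingEnd ℂ (h x)) = starRingEnd ℂ (s x) - s x := by
    filter_upwards [hd] with x hx hxm
    have h1 := huh x (hsub x hxm)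
    have h2 := congrArg (starRingEnd ℂ) h1
    rw [map_mul, map_one] at h2
    rw [hx hxm]
    linear_combination (starRingEnd ℂ (s x) - s x) * h1 * starRingEnd ℂ (u x) *
      starRingEnd ℂ (h x) + (starRingEnd ℂ (s x) - s x) * h2
  -- The numerator equals `(s̄ - s)|u|²`, and by the equations its derivative is `(s̄ - s)(|u|²)'`.
  -- The quotient by `|u|²` therefore has derivative zero, with no differentiation of `s`.
  obtain ⟨c, hc⟩ := hD.const_of_ae_zero_on ha hab.le (by
    filter_upwards [hd] with x hx hxm
    have h2 : h x = (u x)⁻¹ := by rw [hhdef]; simp only [hFeq x (hsub x hxm)]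
    have h3 : u x ≠ 0 := hune x ⟨(hsub x hxm).1.le, (hsub x hxm).2.le⟩
    have h4 : starRingEnd ℂ (u x) ≠ 0 := (map_ne_zero _).2 h3
    simp only [hh' x (hsub x hxm), hx hxm, h2, map_add, map_sub, map_mul, map_neg, map_pow,
      map_inv₀]
    field_simp
    ring)
  refine ⟨a, b, c, by linarith, by linarith, ?_⟩
  filter_upwards [hDeq] with x hx hxm
  rw [← hx hxm]
  exact hc x ⟨hxm.1.le, hxm.2.le⟩

/-- If the quadratic form of the minimal operator is real, then the imaginary part of the
generalized antiderivative is constant. -/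
theorem exists_ae_im_eq_const {s : ℝ → ℂ} (hs : MemL2Loc s)
    (h : ∀ p ∈ minimalGraph s, (inner ℂ p.1 p.2).im = 0) :
    ∃ c : ℝ, ∀ᵐ x ∂halfLine, (s x).im = c := by
  obtain ⟨c, hc⟩ := exists_ae_eq_const_of_locally fun x hx =>
    exists_ae_conj_sub_eq_const_locally hs
      (fun p hp q hq => inner_symm_of_mem_minimalGraph h hp hq) hx
  refine ⟨-c.im / 2, ?_⟩
  filter_upwards [hc] with x hx
  rw [← hx]
  simp

/-! ### Phase of a complex solution for a real antiderivative -/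

theorem HasACDeriv.comp_real {f f' : ℝ → ℝ}
    (hf : HasACDeriv (fun x => (f x : ℂ)) (fun x => (f' x : ℂ))) {φ φ' : ℝ → ℂ}
    (h : ∀ t, HasDerivAt φ (φ' t) t) (hc : Continuous φ') :
    HasACDeriv (fun x => φ (f x)) (fun x => f' x * φ' (f x)) := by
  refine ⟨fun b hb => ?_, ?_⟩
  · have hφ : ContDiff ℝ 1 φ := by
      refine contDiff_one_iff_deriv.2 ⟨fun x => (h x).differentiableAt, ?_⟩
      rwa [show _root_.deriv φ = φ' from funext fun x => (h x).deriv]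
    have hfc : ContinuousOn f (Icc 0 b) :=
      (Complex.continuous_re.comp_continuousOn (hf.continuousOn.mono Icc_subset_Ici_self))
    obtain ⟨K, hK⟩ := (hφ.locallyLipschitz.locallyLipschitzOn
      (s := f '' Icc 0 b)).exists_lipschitzOnWith_of_compact (isCompact_Icc.image_of_continuousOn hfc)
    refine (hf.ac b hb).of_dist_le (C := K) fun x hx y hy => ?_
    rw [uIcc_of_le hb] at hx hy
    have := hK.dist_le_mul _ (mem_image_of_mem _ hx) _ (mem_image_of_mem _ hy)
    have e : dist (f x : ℂ) (f y : ℂ) = dist (f x) (f y) := by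
      rw [Complex.dist_eq, ← Complex.ofReal_sub, Complex.norm_real, Real.dist_eq, Real.norm_eq_abs]
    rwa [e]
  · filter_upwards [hf.deriv] with x h1
    have h2 : HasDerivAt f (f' x) x := Complex.reCLM.hasFDerivAt.comp_hasDerivAt x h1
    have h3 := HasDerivAt.scomp x (h (f x)) h2
    rw [Complex.real_smul] at h3
    exact h3

theorem QuasiSolution.const_mul {s u w : ℝ → ℂ} (h : QuasiSolution s u w) (c : ℂ) :
    QuasiSolution s (fun x => c * u x) (fun x => c * w x) :=
  ⟨(h.fst.const_mul c).congr_deriv (Filter.Eventually.of_forall fun x => by ring),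
    (h.snd.const_mul c).congr_deriv (Filter.Eventually.of_forall fun x => by ring)⟩

theorem QuasiSolution.sub {s u w u' w' : ℝ → ℂ} (h : QuasiSolution s u w)
    (h' : QuasiSolution s u' w') :
    QuasiSolution s (fun x => u x - u' x) (fun x => w x - w' x) :=
  ⟨(h.fst.sub h'.fst).congr_deriv (Filter.Eventually.of_forall fun x => by ring),
    (h.snd.sub h'.snd).congr_deriv (Filter.Eventually.of_forall fun x => by ring)⟩

theorem QuasiSolution.star {σ : ℝ → ℝ} {u w : ℝ → ℂ}
    (h : QuasiSolution (fun x => (σ x : ℂ)) u w) :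
    QuasiSolution (fun x => (σ x : ℂ)) (fun x => starRingEnd ℂ (u x))
      (fun x => starRingEnd ℂ (w x)) :=
  ⟨h.fst.star.congr_deriv (Filter.Eventually.of_forall fun x => by simp),
    h.snd.star.congr_deriv (Filter.Eventually.of_forall fun x => by simp)⟩

/-- A nowhere vanishing solution together with its phase `θ`, so that `ψ e^{-iθ}` is real. -/
structure PhaseSolution (σ : ℝ → ℝ) (ψ w : ℝ → ℂ) (θ : ℝ → ℝ) : Prop where
  sol : QuasiSolution (fun x => (σ x : ℂ)) ψ w
  ne_zero : ∀ x, 0 ≤ x → ψ x ≠ 0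
  phase_zero : θ 0 = 0
  phase_deriv : HasACDeriv (fun x => (θ x : ℂ)) (fun x => (((Complex.normSq (ψ x))⁻¹ : ℝ) : ℂ))
  phase_eq : ∀ x, 0 ≤ x → starRingEnd ℂ (ψ x) * Complex.exp (θ x * Complex.I) ^ 2 = ψ x

/-- For real `σ` the conjugate of a solution is a solution. With initial data `(1, i)` its Wronskian
with `ψ` is `-2i`, which rules out zeros of `ψ` and fixes `θ' = |ψ|⁻²`. -/
theorem exists_phaseSolution {σ : ℝ → ℝ} (hσ : MemL2Loc fun x => (σ x : ℂ)) :
    ∃ ψ w θ, PhaseSolution σ ψ w θ := by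
  obtain ⟨ψ, w, h, hψ0, hw0⟩ := hσ.exists_quasiSolution 1 Complex.I
  have hW : ∀ x, 0 ≤ x → ψ x * starRingEnd ℂ (w x) - w x * starRingEnd ℂ (ψ x)
      = -2 * Complex.I := fun x hx => by
    rw [h.wronskian h.star hx, hψ0, hw0]
    simp only [map_one, mul_one, one_mul, Complex.conj_I]
    ring
  have hne : ∀ x, 0 ≤ x → ψ x ≠ 0 := fun x hx h0 => by
    have := hW x hx
    simp [h0] at this
  have hcont : ContinuousOn (fun x => (Complex.normSq (ψ x))⁻¹) (Ici 0) :=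
    (Complex.continuous_normSq.comp_continuousOn h.fst.continuousOn).inv₀
      fun x hx => by simpa using hne x hx
  have hθ : HasACDeriv (fun x => ((∫ t in (0 : ℝ)..x, (Complex.normSq (ψ t))⁻¹ : ℝ) : ℂ))
      (fun x => (((Complex.normSq (ψ x))⁻¹ : ℝ) : ℂ)) :=
    (HasACDeriv.integral (intervalIntegrable_of_continuousOn_Ici
      (Complex.continuous_ofReal.comp_continuousOn hcont))).congr
      (fun x _ => intervalIntegral.integral_ofReal.symm) (Filter.Eventually.of_forall fun _ => rfl)
  refine ⟨ψ, w, fun x => ∫ t in (0 : ℝ)..x, (Complex.normSq (ψ t))⁻¹, h, hne, by simp, hθ, ?_⟩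
  intro x hx
  have hexp := (hθ.const_mul (2 * Complex.I)).comp Complex.hasDerivAt_exp
  -- By the Wronskian identity `(ψ̄/ψ)e^{2iθ}` has derivative zero, and it equals `1` at the origin.
  have hq := ((h.star.fst.mul (h.fst.inv hne)).mul hexp).eq_of_ae_zero (by
    filter_upwards [ae_pos_halfLine] with x hx
    have h1 := hne x hx.le
    have h2 : starRingEnd ℂ (ψ x) ≠ 0 := (map_ne_zero _).2 h1
    have h3 := hW x hx.le
    rw [Complex.ofReal_inv, Complex.normSq_eq_conj_mul_self]
    generalize Complex.exp _ = e
    field_simp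
    linear_combination e * h3) hx
  simp only [hψ0, intervalIntegral.integral_same, Complex.ofReal_zero, mul_zero, Complex.exp_zero,
    map_one, inv_one, mul_one] at hq
  have h1 := hne x hx
  rw [← Complex.exp_nat_mul, Nat.cast_ofNat, ← mul_assoc, mul_right_comm]
  linear_combination ψ x * hq - starRingEnd ℂ (ψ x) * Complex.exp (2 * Complex.I *
    ((∫ t in (0 : ℝ)..x, (Complex.normSq (ψ t))⁻¹ : ℝ) : ℂ)) * mul_inv_cancel₀ h1

namespace PhaseSolution

variable {σ : ℝ → ℝ} {ψ w : ℝ → ℂ} {θ : ℝ → ℝ}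

theorem normSq_pos (h : PhaseSolution σ ψ w θ) {x : ℝ} (hx : 0 ≤ x) :
    0 < Complex.normSq (ψ x) := Complex.normSq_pos.2 (h.ne_zero x hx)

theorem continuousOn_normSq (h : PhaseSolution σ ψ w θ) :
    ContinuousOn (fun x => Complex.normSq (ψ x)) (Ici 0) :=
  Complex.continuous_normSq.comp_continuousOn h.sol.fst.continuousOn

theorem continuousOn_inv (h : PhaseSolution σ ψ w θ) :
    ContinuousOn (fun x => (Complex.normSq (ψ x))⁻¹) (Ici 0) :=
  h.continuousOn_normSq.inv₀ fun _ hx => (h.normSq_pos hx).ne'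

theorem continuousOn_phase (h : PhaseSolution σ ψ w θ) : ContinuousOn θ (Ici 0) :=
  Complex.continuous_re.comp_continuousOn h.phase_deriv.continuousOn

theorem intervalIntegrable {f : ℝ → ℝ} (hf : ContinuousOn f (Ici 0)) {a b : ℝ} (ha : 0 ≤ a)
    (hab : a ≤ b) : IntervalIntegrable f volume a b :=
  (hf.mono (by rw [uIcc_of_le hab]; exact fun x hx => ha.trans hx.1)).intervalIntegrable

/-- Integrals of derivatives of functions of the phase. -/
theorem integral_deriv_phase (h : PhaseSolution σ ψ w θ) {F F' : ℝ → ℝ}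
    (hF : ∀ t, HasDerivAt F (F' t) t) (hc : Continuous F') {x : ℝ} (hx : 0 ≤ x) :
    ∫ t in (0 : ℝ)..x, (Complex.normSq (ψ t))⁻¹ * F' (θ t) = F (θ x) - F 0 := by
  have h1 := (h.phase_deriv.comp_real (φ := fun t => (F t : ℂ)) (φ' := fun t => (F' t : ℂ))
    (fun t => (hF t).ofReal_comp) (Complex.continuous_ofReal.comp hc)).integral_eq hx
  rw [h.phase_zero] at h1
  simp only [← Complex.ofReal_mul] at h1
  rw [intervalIntegral.integral_ofReal] at h1
  exact_mod_cast h1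

theorem phase_strictMonoOn (h : PhaseSolution σ ψ w θ) : StrictMonoOn θ (Ici 0) := by
  have key : ∀ x, 0 ≤ x → ∫ t in (0 : ℝ)..x, (Complex.normSq (ψ t))⁻¹ = θ x := fun x hx => by
    simpa using h.integral_deriv_phase (F := id) (F' := fun _ => 1) hasDerivAt_id
      continuous_const hx
  intro x hx y hy hxy
  have hx' : (0 : ℝ) ≤ x := hx
  rw [← sub_pos, ← key x hx, ← key y hy, intervalIntegral.integral_interval_sub_left
    (intervalIntegrable h.continuousOn_inv le_rfl hy)
    (intervalIntegrable h.continuousOn_inv le_rfl hx)]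
  exact intervalIntegral.intervalIntegral_pos_of_pos_on
    (intervalIntegrable h.continuousOn_inv hx hxy.le)
    (fun t ht => inv_pos.2 (h.normSq_pos (hx'.trans ht.1.le))) hxy

/-- The trial function is `ψe^{-iθ}φ(θ)`, of modulus `|ψ||φ(θ)|`. In the variable `θ` the operator
acts as `-φ'' - φ`, and integration by parts gives the right-hand side. The four vanishing
conditions are exactly those needed to extend by zero inside the minimal domain. -/
theorem form_le (h : PhaseSolution σ ψ w θ)
    (hQ : ∀ p ∈ minimalGraph fun x => (σ x : ℂ), ∃ r : ℝ, 0 ≤ r ∧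
      inner ℂ p.1 p.2 = ((‖p.1‖ ^ 2 + r : ℝ) : ℂ))
    {φ φ' φ'' : ℝ → ℝ} (hφ : ∀ t, HasDerivAt φ (φ' t) t) (hφ' : ∀ t, HasDerivAt φ' (φ'' t) t)
    (hc : Continuous φ'') {N : ℝ} (hN : 0 ≤ N) (h0 : φ 0 = 0) (h0' : φ' 0 = 0)
    (hθN : φ (θ N) = 0) (hθN' : φ' (θ N) = 0) :
    ∫ x in (0 : ℝ)..N, Complex.normSq (ψ x) * φ (θ x) ^ 2 ≤
      ∫ x in (0 : ℝ)..N, (Complex.normSq (ψ x))⁻¹ * (φ' (θ x) ^ 2 - φ (θ x) ^ 2) := by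
  have hφc : Continuous φ := continuous_iff_continuousAt.2 fun t => (hφ t).continuousAt
  have hφc' : Continuous φ' := continuous_iff_continuousAt.2 fun t => (hφ' t).continuousAt
  have hexp : ∀ t : ℝ, HasDerivAt (fun t : ℝ => Complex.exp (t * Complex.I))
      (Complex.exp (t * Complex.I) * Complex.I) t := fun t => by
    simpa using ((hasDerivAt_id t).ofReal_comp.mul_const Complex.I).cexp
  have hexp' : ∀ t : ℝ, HasDerivAt (fun t : ℝ => Complex.exp (-(t * Complex.I)))
      (Complex.exp (-(t * Complex.I)) * -Complex.I) t := fun t => by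
    simpa using ((hasDerivAt_id t).ofReal_comp.mul_const Complex.I).fun_neg.cexp
  have hg := h.phase_deriv.comp_real
    (φ := fun t => (φ t : ℂ) * Complex.exp (-(t * Complex.I)))
    (φ' := fun t => φ' t * Complex.exp (-(t * Complex.I)) +
      φ t * (Complex.exp (-(t * Complex.I)) * -Complex.I))
    (fun t => (hφ t).ofReal_comp.mul (hexp' t)) (by fun_prop)
  have hG := h.phase_deriv.comp_real
    (φ := fun t => ((φ' t : ℂ) - Complex.I * φ t) * Complex.exp (t * Complex.I))
    (φ' := fun t => ((φ'' t : ℂ) - Complex.I * φ' t) * Complex.exp (t * Complex.I) +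
      (φ' t - Complex.I * φ t) * (Complex.exp (t * Complex.I) * Complex.I))
    (fun t =>
    (((hφ' t).ofReal_comp.sub ((hφ t).ofReal_comp.const_mul Complex.I))).mul (hexp t))
    (by fun_prop)
  -- This rewrites `g'` for `g = φ(θ)e^{-iθ}` as `G/ψ²` with `G = (φ' - iφ)(θ)e^{iθ}`, the form
  -- required by variation of constants.
  have hgG : ∀ x, 0 ≤ x → (((Complex.normSq (ψ x))⁻¹ : ℝ) : ℂ) * Complex.exp (-(θ x * Complex.I))
      = Complex.exp (θ x * Complex.I) * (ψ x)⁻¹ ^ 2 := by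
    intro x hx
    have h1 := h.ne_zero x hx
    have h2 : starRingEnd ℂ (ψ x) ≠ 0 := (map_ne_zero _).2 h1
    have h3 := h.phase_eq x hx
    rw [Complex.exp_neg, Complex.ofReal_inv, Complex.normSq_eq_conj_mul_self]
    have h4 := Complex.exp_ne_zero (θ x * Complex.I)
    field_simp
    linear_combination -h3
  obtain ⟨p, hp, hp1, hp2⟩ := h.sol.exists_mem_minimalGraph
    (N := N) (hg.congr_deriv (g' := fun x => ((φ' (θ x) : ℂ) - Complex.I * φ (θ x)) *
      Complex.exp (θ x * Complex.I) * (ψ x)⁻¹ ^ 2) (by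
        filter_upwards [ae_pos_halfLine] with x hx
        linear_combination (-((φ' (θ x) : ℂ) - Complex.I * φ (θ x))) * hgG x hx.le))
    hG (h.sol.fst.inv h.ne_zero)
    ((Complex.continuous_ofReal.comp_continuousOn h.continuousOn_inv).mul
      (Continuous.comp_continuousOn (g := fun t : ℝ =>
        ((φ'' t : ℂ) - Complex.I * φ' t) * Complex.exp (t * Complex.I) +
          (φ' t - Complex.I * φ t) * (Complex.exp (t * Complex.I) * Complex.I))
        (by fun_prop) h.continuousOn_phase))
    (by
      filter_upwards [ae_pos_halfLine] with x hx _
      refine ⟨mul_inv_cancel₀ (h.ne_zero x hx.le), ?_⟩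
      rw [inv_pow, div_eq_mul_inv])
    hN (by simp [h.phase_zero, h0]) (by simp [h.phase_zero, h0, h0']) (by simp [hθN])
    (by simp [hθN, hθN'])
  obtain ⟨r, hr, e⟩ := hQ p hp
  have hbound : ∀ x, x ∈ uIcc 0 N → 0 ≤ x ∧ x ∈ Iic N := fun x hx => by
    rw [uIcc_of_le hN] at hx; exact hx
  have e1 : inner ℂ p.1 p.2 = ((∫ x in (0 : ℝ)..N,
      -((Complex.normSq (ψ x))⁻¹ * ((φ'' (θ x) + φ (θ x)) * φ (θ x))) : ℝ) : ℂ) := by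
    rw [inner_L2HalfLine_eq hp1 hp2, integral_halfLine_eq hN, ← intervalIntegral.integral_ofReal]
    · refine intervalIntegral.integral_congr fun x hx => ?_
      obtain ⟨hx0, hxN⟩ := hbound x hx
      have h1 := h.ne_zero x hx0
      have h3 := h.phase_eq x hx0
      have h5 : starRingEnd ℂ (Complex.exp (-(θ x * Complex.I))) = Complex.exp (θ x * Complex.I) := by
        rw [← Complex.exp_conj]; simp
      simp only [indicator_of_mem hxN, map_mul, Complex.conj_ofReal, h5]
      push_cast
      have h6 : starRingEnd ℂ (ψ x) * Complex.exp (θ x * Complex.I) ^ 2 * (ψ x)⁻¹ = 1 := by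
        rw [h3, mul_inv_cancel₀ h1]
      linear_combination (-(Complex.normSq (ψ x) : ℂ)⁻¹ * φ (θ x) *
        (φ'' (θ x) + φ (θ x))) * h6 + (Complex.normSq (ψ x) : ℂ)⁻¹ * φ (θ x) * φ (θ x) *
          starRingEnd ℂ (ψ x) *
          Complex.exp (θ x * Complex.I) ^ 2 * (ψ x)⁻¹ * Complex.I_sq
    · exact Filter.Eventually.of_forall fun x hx => by simp [indicator, not_le.2 hx]
  have e2 : ‖p.1‖ ^ 2 = ∫ x in (0 : ℝ)..N, Complex.normSq (ψ x) * φ (θ x) ^ 2 := by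
    rw [← Complex.ofReal_inj, ofReal_norm_sq_L2HalfLine_eq hp1, integral_halfLine_eq hN,
      ← intervalIntegral.integral_ofReal]
    · refine intervalIntegral.integral_congr fun x hx => ?_
      obtain ⟨hx0, hxN⟩ := hbound x hx
      have h5 : starRingEnd ℂ (Complex.exp (-(θ x * Complex.I))) = Complex.exp (θ x * Complex.I) := by
        rw [← Complex.exp_conj]; simp
      simp only [indicator_of_mem hxN, map_mul, Complex.conj_ofReal, h5]
      have h6 : Complex.exp (θ x * Complex.I) * Complex.exp (-(θ x * Complex.I)) = 1 := by
        rw [← Complex.exp_add]; simp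
      push_cast
      rw [Complex.normSq_eq_conj_mul_self]
      linear_combination starRingEnd ℂ (ψ x) * ψ x * φ (θ x) ^ 2 * h6
    · exact Filter.Eventually.of_forall fun x hx => by simp [indicator, not_le.2 hx]
  rw [e1, Complex.ofReal_inj, e2] at e
  have e3 := h.integral_deriv_phase (F := fun t => φ t * φ' t)
    (fun t => (hφ t).mul (hφ' t)) (by fun_prop) hN
  rw [hθN, h0, zero_mul, zero_mul, sub_zero] at e3
  have hcomp : ∀ {f : ℝ → ℝ}, Continuous f → IntervalIntegrable
      (fun x => (Complex.normSq (ψ x))⁻¹ * f (θ x)) volume 0 N := fun hf =>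
    intervalIntegrable (h.continuousOn_inv.mul (hf.comp_continuousOn h.continuousOn_phase)) le_rfl hN
  have e4 : ∫ x in (0 : ℝ)..N, (Complex.normSq (ψ x))⁻¹ * (φ' (θ x) ^ 2 - φ (θ x) ^ 2) =
      (∫ x in (0 : ℝ)..N, (Complex.normSq (ψ x))⁻¹ * (φ' (θ x) * φ' (θ x) + φ (θ x) * φ'' (θ x)))
      + ∫ x in (0 : ℝ)..N, -((Complex.normSq (ψ x))⁻¹ * ((φ'' (θ x) + φ (θ x)) * φ (θ x))) := by
    rw [← intervalIntegral.integral_add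
      (hcomp (f := fun t => φ' t * φ' t + φ t * φ'' t) (by fun_prop))
      (show IntervalIntegrable (fun x => -((Complex.normSq (ψ x))⁻¹ *
          ((φ'' (θ x) + φ (θ x)) * φ (θ x)))) volume 0 N from
        (hcomp (f := fun t => (φ'' t + φ t) * φ t) (by fun_prop)).neg)]
    exact intervalIntegral.integral_congr fun x _ => by ring
  rw [e4, e3, e]
  linarith

end PhaseSolution

/-! ### Sine trial functions and the bound on the total phase -/

namespace PhaseSolution

variable {σ : ℝ → ℝ} {ψ w : ℝ → ℂ} {θ : ℝ → ℝ}

theorem hasDerivAt_sub_arctan_div {n : ℝ} (hn : n ≠ 0) (x : ℝ) :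
    HasDerivAt (fun x => x - Real.arctan (n * x) / n) (1 - (1 + (n * x) ^ 2)⁻¹) x := by
  have h1 : HasDerivAt (fun x : ℝ => n * x) n x := by simpa using (hasDerivAt_id x).const_mul n
  have h2 := (hasDerivAt_id x).fun_sub (h1.arctan.div_const n)
  refine h2.congr_deriv ?_
  field_simp

theorem hasDerivAt_one_sub_inv {n : ℝ} (x : ℝ) :
    HasDerivAt (fun x => 1 - (1 + (n * x) ^ 2)⁻¹) (2 * n ^ 2 * x / (1 + (n * x) ^ 2) ^ 2) x := by
  have h1 : HasDerivAt (fun x : ℝ => n * x) n x := by simpa using (hasDerivAt_id x).const_mul n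
  have h2 := (((h1.fun_pow 2).const_add 1).fun_inv (by positivity)).const_sub 1
  refine h2.congr_deriv ?_
  push_cast
  ring

theorem hasDerivAt_sin_mul (k t : ℝ) :
    HasDerivAt (fun t => Real.sin (k * t)) (k * Real.cos (k * t)) t := by
  have h1 : HasDerivAt (fun x : ℝ => k * x) k t := by simpa using (hasDerivAt_id t).const_mul k
  simpa [mul_comm] using h1.sin

theorem hasDerivAt_cos_mul (k t : ℝ) :
    HasDerivAt (fun t => k * Real.cos (k * t)) (-(k ^ 2 * Real.sin (k * t))) t := by
  have h1 : HasDerivAt (fun x : ℝ => k * x) k t := by simpa using (hasDerivAt_id t).const_mul k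
  refine (h1.cos.const_mul k).congr_deriv ?_
  ring

/-- The sine vanishes at both ends but its derivative does not, so it is not admissible. It is
composed with `η(x) = x - arctan(nx)/n`, which satisfies `η(0) = η'(0) = 0`, `η'² ≤ 1` and `|η(x) -
x| ≤ π/(2n)`. This costs only the error `π/n`. -/
theorem sin_form_le_aux (h : PhaseSolution σ ψ w θ)
    (hQ : ∀ p ∈ minimalGraph fun x => (σ x : ℂ), ∃ r : ℝ, 0 ≤ r ∧
      inner ℂ p.1 p.2 = ((‖p.1‖ ^ 2 + r : ℝ) : ℂ))
    {N : ℝ} (hN : 0 ≤ N) {k n : ℝ} (hk : k * θ N = Real.pi) (hn : 0 < n) :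
    ∫ x in (0 : ℝ)..N, Complex.normSq (ψ x) * (Real.sin (k * θ x) ^ 2 - Real.pi / n) ≤
      ∫ x in (0 : ℝ)..N, (Complex.normSq (ψ x))⁻¹ *
        ((k * Real.cos (k * θ x)) ^ 2 - (Real.sin (k * θ x) ^ 2 - Real.pi / n)) := by
  set η : ℝ → ℝ := fun x => x - Real.arctan (n * x) / n with hη
  set η' : ℝ → ℝ := fun x => 1 - (1 + (n * x) ^ 2)⁻¹ with hη'
  have hφ : ∀ t, HasDerivAt (fun t => η (Real.sin (k * t)))
      (η' (Real.sin (k * t)) * (k * Real.cos (k * t))) t := fun t =>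
    HasDerivAt.comp (h₂ := η) (h := fun t => Real.sin (k * t)) t
      (hasDerivAt_sub_arctan_div hn.ne' _) (hasDerivAt_sin_mul k t)
  have hφ' : ∀ t, HasDerivAt (fun t => η' (Real.sin (k * t)) * (k * Real.cos (k * t)))
      ((2 * n ^ 2 * Real.sin (k * t) / (1 + (n * Real.sin (k * t)) ^ 2) ^ 2 *
        (k * Real.cos (k * t))) * (k * Real.cos (k * t)) +
        η' (Real.sin (k * t)) * -(k ^ 2 * Real.sin (k * t))) t := fun t =>
    (HasDerivAt.comp (h₂ := η') (h := fun t => Real.sin (k * t)) t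
      (hasDerivAt_one_sub_inv _) (hasDerivAt_sin_mul k t)).mul (hasDerivAt_cos_mul k t)
  have hpos : ∀ x : ℝ, 0 < 1 + (n * x) ^ 2 := fun x => by positivity
  have hη'c : Continuous η' :=
    continuous_const.sub ((by fun_prop : Continuous fun x : ℝ => 1 + (n * x) ^ 2).inv₀
      fun x => (hpos x).ne')
  have hφ''c : Continuous fun t => (2 * n ^ 2 * Real.sin (k * t) /
        (1 + (n * Real.sin (k * t)) ^ 2) ^ 2 *
        (k * Real.cos (k * t))) * (k * Real.cos (k * t)) +
        η' (Real.sin (k * t)) * -(k ^ 2 * Real.sin (k * t)) := by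
    have h1 : Continuous fun t => 2 * n ^ 2 * Real.sin (k * t) /
        (1 + (n * Real.sin (k * t)) ^ 2) ^ 2 :=
      Continuous.div (by fun_prop) (by fun_prop) fun t => (pow_pos (hpos _) 2).ne'
    fun_prop
  have hηc : Continuous η := by fun_prop
  have hmain := h.form_le hQ hφ hφ' hφ''c hN (by simp [η]) (by simp [η']) (by simp [η, hk])
    (by simp [η', hk])
  have hη1 : ∀ x, η' x ^ 2 ≤ 1 := fun x => by
    have h1 : (1 + (n * x) ^ 2)⁻¹ ≤ 1 := inv_le_one_of_one_le₀ (by nlinarith [sq_nonneg (n * x)])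
    have h2 : 0 < (1 + (n * x) ^ 2)⁻¹ := inv_pos.2 (hpos x)
    simp only [hη']
    nlinarith
  have hη2 : ∀ t, Real.sin t ^ 2 - Real.pi / n ≤ η (Real.sin t) ^ 2 := fun t => by
    set a := Real.arctan (n * Real.sin t) / n with ha
    have h1 : |a| ≤ Real.pi / 2 / n := by
      rw [ha, abs_div, abs_of_pos hn]
      gcongr
      exact (abs_lt.2 ⟨Real.neg_pi_div_two_lt_arctan _, Real.arctan_lt_pi_div_two _⟩).le
    have h2 : |Real.sin t * a| ≤ 1 * (Real.pi / 2 / n) := by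
      rw [abs_mul]
      exact mul_le_mul (Real.abs_sin_le_one t) h1 (abs_nonneg _) zero_le_one
    have h3 := (le_abs_self _).trans h2
    have h4 : Real.pi / n = 2 * (Real.pi / 2 / n) := by ring
    have h5 : η (Real.sin t) = Real.sin t - a := rfl
    rw [h5, h4]
    nlinarith [sq_nonneg a]
  have hcomp : ∀ {f : ℝ → ℝ}, Continuous f → ContinuousOn (fun x => f (θ x)) (Ici 0) :=
    fun hf => hf.comp_continuousOn h.continuousOn_phase
  have hsin : ContinuousOn (fun x => Real.sin (k * θ x) ^ 2 - Real.pi / n) (Ici 0) :=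
    hcomp (f := fun t => Real.sin (k * t) ^ 2 - Real.pi / n) (by fun_prop)
  refine le_trans (intervalIntegral.integral_mono_on hN ?_ ?_ fun x hx => ?_)
    (hmain.trans (intervalIntegral.integral_mono_on hN ?_ ?_ fun x hx => ?_))
  · exact intervalIntegrable (h.continuousOn_normSq.mul hsin) le_rfl hN
  · exact intervalIntegrable (h.continuousOn_normSq.mul
      (hcomp (f := fun t => η (Real.sin (k * t)) ^ 2) (by fun_prop))) le_rfl hN
  · exact mul_le_mul_of_nonneg_left (hη2 _) (Complex.normSq_nonneg _)
  · exact intervalIntegrable (h.continuousOn_inv.mul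
      (hcomp (f := fun t => (η' (Real.sin (k * t)) * (k * Real.cos (k * t))) ^ 2 -
        η (Real.sin (k * t)) ^ 2) (by fun_prop))) le_rfl hN
  · exact intervalIntegrable (h.continuousOn_inv.mul
      (hcomp (f := fun t => (k * Real.cos (k * t)) ^ 2 - (Real.sin (k * t) ^ 2 - Real.pi / n))
        (by fun_prop))) le_rfl hN
  · refine mul_le_mul_of_nonneg_left (sub_le_sub ?_ (hη2 _))
      (inv_nonneg.2 (Complex.normSq_nonneg _))
    rw [mul_pow]
    exact mul_le_of_le_one_left (sq_nonneg _) (hη1 _)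

theorem sin_form_le (h : PhaseSolution σ ψ w θ)
    (hQ : ∀ p ∈ minimalGraph fun x => (σ x : ℂ), ∃ r : ℝ, 0 ≤ r ∧
      inner ℂ p.1 p.2 = ((‖p.1‖ ^ 2 + r : ℝ) : ℂ))
    {N : ℝ} (hN : 0 ≤ N) {k : ℝ} (hk : k * θ N = Real.pi) :
    ∫ x in (0 : ℝ)..N, Complex.normSq (ψ x) * Real.sin (k * θ x) ^ 2 ≤
      (k ^ 2 - 1) / 2 * θ N := by
  have hk0 : k ≠ 0 := by rintro rfl; simp [Real.pi_ne_zero.symm] at hk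
  have hcomp : ∀ {f : ℝ → ℝ}, Continuous f → ContinuousOn (fun x => f (θ x)) (Ici 0) :=
    fun hf => hf.comp_continuousOn h.continuousOn_phase
  have i1 : IntervalIntegrable (fun x => Complex.normSq (ψ x) * Real.sin (k * θ x) ^ 2)
      volume 0 N := intervalIntegrable (h.continuousOn_normSq.mul
    (hcomp (f := fun t => Real.sin (k * t) ^ 2) (by fun_prop))) le_rfl hN
  have i2 : IntervalIntegrable (fun x => (Complex.normSq (ψ x))⁻¹ *
      ((k * Real.cos (k * θ x)) ^ 2 - Real.sin (k * θ x) ^ 2)) volume 0 N :=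
      intervalIntegrable (h.continuousOn_inv.mul
    (hcomp (f := fun t => (k * Real.cos (k * t)) ^ 2 - Real.sin (k * t) ^ 2)
      (by fun_prop))) le_rfl hN
  have i3 := intervalIntegrable h.continuousOn_normSq le_rfl hN
  have i4 := intervalIntegrable h.continuousOn_inv le_rfl hN
  have e1 : ∫ x in (0 : ℝ)..N, (Complex.normSq (ψ x))⁻¹ *
      ((k * Real.cos (k * θ x)) ^ 2 - Real.sin (k * θ x) ^ 2) = (k ^ 2 - 1) / 2 * θ N := by
    -- The oscillating term of this antiderivative vanishes at both ends because `k θ(N) = π`.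
    rw [h.integral_deriv_phase
      (F := fun t => (k ^ 2 - 1) / 2 * t + (k ^ 2 + 1) / (2 * k) * Real.sin (k * t) *
        Real.cos (k * t)) (F' := fun t => (k * Real.cos (k * t)) ^ 2 - Real.sin (k * t) ^ 2) ?_
      (by fun_prop) hN, hk]
    · simp
    · intro t
      have h1 : HasDerivAt (fun x : ℝ => k * x) k t := by
        simpa using (hasDerivAt_id t).const_mul k
      refine (((hasDerivAt_id t).const_mul ((k ^ 2 - 1) / 2)).fun_add
        ((h1.sin.const_mul ((k ^ 2 + 1) / (2 * k))).fun_mul h1.cos)).congr_deriv ?_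
      field_simp
      linear_combination (1 - k ^ 2) * (Real.sin_sq_add_cos_sq (k * t))
  by_contra! hlt
  set X := (∫ x in (0 : ℝ)..N, Complex.normSq (ψ x) * Real.sin (k * θ x) ^ 2) -
    (k ^ 2 - 1) / 2 * θ N with hX
  have hX0 : 0 < X := sub_pos.2 hlt
  set C := (∫ x in (0 : ℝ)..N, Complex.normSq (ψ x)) +
    ∫ x in (0 : ℝ)..N, (Complex.normSq (ψ x))⁻¹ with hC
  have hC0 : 0 ≤ C := add_nonneg
    (intervalIntegral.integral_nonneg hN fun x _ => Complex.normSq_nonneg _)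
    (intervalIntegral.integral_nonneg hN fun x _ => inv_nonneg.2 (Complex.normSq_nonneg _))
  have hbd : ∀ n : ℝ, 0 < n → n * X ≤ Real.pi * C := by
    intro n hn
    have hm := h.sin_form_le_aux hQ hN hk hn
    have e2 : ∫ x in (0 : ℝ)..N, Complex.normSq (ψ x) * (Real.sin (k * θ x) ^ 2 - Real.pi / n) =
        (∫ x in (0 : ℝ)..N, Complex.normSq (ψ x) * Real.sin (k * θ x) ^ 2) -
          (∫ x in (0 : ℝ)..N, Complex.normSq (ψ x)) * (Real.pi / n) := by
      rw [← intervalIntegral.integral_mul_const, ← intervalIntegral.integral_sub i1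
        (i3.mul_const _)]
      exact intervalIntegral.integral_congr fun x _ => by ring
    have e3 : ∫ x in (0 : ℝ)..N, (Complex.normSq (ψ x))⁻¹ *
        ((k * Real.cos (k * θ x)) ^ 2 - (Real.sin (k * θ x) ^ 2 - Real.pi / n)) =
        (k ^ 2 - 1) / 2 * θ N +
          (∫ x in (0 : ℝ)..N, (Complex.normSq (ψ x))⁻¹) * (Real.pi / n) := by
      rw [← e1, ← intervalIntegral.integral_mul_const, ← intervalIntegral.integral_add i2
        (i4.mul_const _)]
      exact intervalIntegral.integral_congr fun x _ => by ring
    rw [e2, e3] at hm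
    have h1 : X ≤ C * (Real.pi / n) := by rw [hX, hC, add_mul]; linarith
    calc n * X ≤ n * (C * (Real.pi / n)) := mul_le_mul_of_nonneg_left h1 hn.le
      _ = Real.pi * C := by field_simp
  have hpC : 0 ≤ Real.pi * C := mul_nonneg Real.pi_pos.le hC0
  -- For this `n` the bound would read `πC + 1 ≤ πC`.
  have := hbd ((Real.pi * C + 1) / X) (by positivity)
  rw [div_mul_cancel₀ _ hX0.ne'] at this
  linarith

/-- With `k = π/θ(N)`, the sine inequality bounds a positive quantity by `(k² - 1)θ(N)/2`, so `θ(N)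
< π`. To make the gap uniform, the left side is estimated from below on a fixed interval `[0, x₁]`,
giving `8ε ≤ (π² - θ(N)²)θ(N)` with `ε` independent of `N`. -/
theorem exists_phase_bound (h : PhaseSolution σ ψ w θ)
    (hQ : ∀ p ∈ minimalGraph fun x => (σ x : ℂ), ∃ r : ℝ, 0 ≤ r ∧
      inner ℂ p.1 p.2 = ((‖p.1‖ ^ 2 + r : ℝ) : ℂ)) :
    ∃ M < Real.pi, ∀ x, 0 ≤ x → θ x ≤ M := by
  have hmono := h.phase_strictMonoOn
  have hpos : ∀ x, 0 < x → 0 < θ x := fun x hx => by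
    have := hmono (mem_Ici.2 le_rfl) (mem_Ici.2 hx.le) hx
    rwa [h.phase_zero] at this
  have hnn : ∀ x, 0 ≤ x → 0 ≤ θ x := fun x hx => by
    rcases hx.eq_or_lt with rfl | hx
    · rw [h.phase_zero]
    · exact (hpos x hx).le
  have h1pos := hpos 1 one_pos
  -- Up to `x₁` the phase is at most `θ(1)/2 ≤ θ(N)/2`, so for every `N ≥ 1` the argument of the
  -- sine stays in `[0, π/2]`, where `sin t ≥ 2t/π`.
  obtain ⟨x₁, hx₁, hθ₁⟩ := intermediate_value_Icc zero_le_one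
    (h.continuousOn_phase.mono Icc_subset_Ici_self)
    (show θ 1 / 2 ∈ Icc (θ 0) (θ 1) by rw [h.phase_zero]; constructor <;> linarith)
  have hx₁0 : 0 < x₁ := lt_of_le_of_ne hx₁.1 fun h0 => by
    rw [← h0, h.phase_zero] at hθ₁
    linarith
  have hcε : ContinuousOn (fun x => Complex.normSq (ψ x) * θ x ^ 2) (Ici 0) :=
    h.continuousOn_normSq.mul (h.continuousOn_phase.pow 2)
  set ε := ∫ x in (0 : ℝ)..x₁, Complex.normSq (ψ x) * θ x ^ 2 with hε
  have hε0 : 0 < ε := intervalIntegral.intervalIntegral_pos_of_pos_on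
    (intervalIntegrable hcε le_rfl hx₁0.le)
    (fun x hx => mul_pos (h.normSq_pos hx.1.le) (pow_pos (hpos x hx.1) 2)) hx₁0
  have key : ∀ N, 1 ≤ N → 8 * ε ≤ (Real.pi ^ 2 - θ N ^ 2) * θ N := by
    intro N hN1
    have hN : 0 ≤ N := zero_le_one.trans hN1
    have hΘ := hpos N (zero_lt_one.trans_le hN1)
    have hΘ1 : θ 1 ≤ θ N := hmono.monotoneOn (mem_Ici.2 zero_le_one) (mem_Ici.2 hN) hN1
    have hk : Real.pi / θ N * θ N = Real.pi := div_mul_cancel₀ _ hΘ.ne'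
    have hle := h.sin_form_le hQ hN hk
    have hcs : ContinuousOn (fun x => Complex.normSq (ψ x) * Real.sin (Real.pi / θ N * θ x) ^ 2)
        (Ici 0) := h.continuousOn_normSq.mul
      (Continuous.comp_continuousOn (g := fun t => Real.sin (Real.pi / θ N * t) ^ 2)
        (by fun_prop) h.continuousOn_phase)
    have h2 : ∫ x in (0 : ℝ)..x₁, 4 / θ N ^ 2 * (Complex.normSq (ψ x) * θ x ^ 2) ≤
        ∫ x in (0 : ℝ)..x₁, Complex.normSq (ψ x) * Real.sin (Real.pi / θ N * θ x) ^ 2 := by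
      refine intervalIntegral.integral_mono_on hx₁0.le
        ((intervalIntegrable hcε le_rfl hx₁0.le).const_mul _)
        (intervalIntegrable hcs le_rfl hx₁0.le) fun x hx => ?_
      have hθx : θ x ≤ θ 1 / 2 := by
        rw [← hθ₁]
        exact hmono.monotoneOn (mem_Ici.2 hx.1) (mem_Ici.2 hx₁0.le) hx.2
      have hθx0 := hnn x hx.1
      have h3 : 2 / Real.pi * (Real.pi / θ N * θ x) ≤ Real.sin (Real.pi / θ N * θ x) := by
        refine Real.mul_le_sin (by positivity) ?_
        rw [div_mul_eq_mul_div, div_le_iff₀ hΘ]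
        nlinarith [Real.pi_pos]
      have h4 : 2 / Real.pi * (Real.pi / θ N * θ x) = 2 / θ N * θ x := by
        field_simp [Real.pi_ne_zero]
      rw [h4] at h3
      have h5 : (2 / θ N * θ x) ^ 2 ≤ Real.sin (Real.pi / θ N * θ x) ^ 2 :=
        pow_le_pow_left₀ (by positivity) h3 2
      calc _ = Complex.normSq (ψ x) * (2 / θ N * θ x) ^ 2 := by ring
        _ ≤ _ := mul_le_mul_of_nonneg_left h5 (Complex.normSq_nonneg _)
    have h6 : ∫ x in (0 : ℝ)..x₁, Complex.normSq (ψ x) * Real.sin (Real.pi / θ N * θ x) ^ 2 ≤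
        ∫ x in (0 : ℝ)..N, Complex.normSq (ψ x) * Real.sin (Real.pi / θ N * θ x) ^ 2 :=
      intervalIntegral.integral_mono_interval le_rfl hx₁0.le (hx₁.2.trans hN1)
        (Filter.Eventually.of_forall fun x => mul_nonneg (Complex.normSq_nonneg _) (sq_nonneg _))
        (intervalIntegrable hcs le_rfl hN)
    rw [intervalIntegral.integral_const_mul, ← hε] at h2
    have h7 := h2.trans (h6.trans hle)
    have h8 : 8 * ε = 2 * θ N ^ 2 * (4 / θ N ^ 2 * ε) := by field_simp; ring
    have h9 : (Real.pi ^ 2 - θ N ^ 2) * θ N =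
        2 * θ N ^ 2 * (((Real.pi / θ N) ^ 2 - 1) / 2 * θ N) := by field_simp
    rw [h8, h9]
    exact mul_le_mul_of_nonneg_left h7 (by positivity)
  have hlt : ∀ N, 1 ≤ N → θ N ^ 2 ≤ Real.pi ^ 2 - 8 * ε / Real.pi := by
    intro N hN
    have h1 := key N hN
    have h2 := hpos N (zero_lt_one.trans_le hN)
    have h3 : 0 < Real.pi ^ 2 - θ N ^ 2 := by
      by_contra hc
      nlinarith
    have h4 : θ N < Real.pi := by nlinarith [Real.pi_pos]
    have h5 : 8 * ε / Real.pi ≤ Real.pi ^ 2 - θ N ^ 2 := by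
      rw [div_le_iff₀ Real.pi_pos]
      nlinarith
    linarith
  refine ⟨√(Real.pi ^ 2 - 8 * ε / Real.pi), ?_, fun x hx => ?_⟩
  · rw [Real.sqrt_lt' Real.pi_pos]
    have : 0 < 8 * ε / Real.pi := by positivity
    linarith
  · have h1 : θ x ≤ θ (max x 1) := hmono.monotoneOn (mem_Ici.2 hx)
      (mem_Ici.2 (hx.trans (le_max_left _ _))) (le_max_left _ _)
    exact h1.trans (Real.le_sqrt_of_sq_le (hlt _ (le_max_right _ _)))

end PhaseSolution

/-! ### The Riccati equation and the representation -/

/-- For a nowhere vanishing solution `U` with quasi-derivative `W` and real quotient `τ = W/U`, the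
system gives `τ' = -(σ + τ)²`. Hence `γ = σ + τ` satisfies `τ + ∫γ² = τ(0)`, which is the
representation with `C = -τ(0)`. -/
theorem exists_riccati_of_form_ge {σ : ℝ → ℝ} (hσ : MemL2Loc fun x => (σ x : ℂ))
    (hQ : ∀ p ∈ minimalGraph fun x => (σ x : ℂ), ∃ r : ℝ, 0 ≤ r ∧
      inner ℂ p.1 p.2 = ((‖p.1‖ ^ 2 + r : ℝ) : ℂ)) :
    ∃ (γ : ℝ → ℝ) (C : ℂ), MemL2Loc γ ∧ ∀ x, 0 ≤ x →
      (σ x : ℂ) = γ x + ((∫ t in (0 : ℝ)..x, γ t ^ 2 : ℝ) : ℂ) + C := by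
  obtain ⟨ψ, w, θ, h⟩ := exists_phaseSolution hσ
  obtain ⟨M, hM, hθM⟩ := h.exists_phase_bound hQ
  have hθ0 : ∀ x, 0 ≤ x → 0 ≤ θ x := fun x hx => by
    have := h.phase_strictMonoOn.monotoneOn (mem_Ici.2 le_rfl) (mem_Ici.2 hx) hx
    rwa [h.phase_zero] at this
  -- With this rotation `θ + δ` lies in `[δ, π - δ]`, so `U = 2i Im(e^{iδ}ψ)` has no zero. The
  -- factor `2i` cancels in `W/U`.
  set δ := (Real.pi - M) / 2 with hδ
  have hsol := (h.sol.const_mul (Complex.exp (δ * Complex.I))).sub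
    (h.sol.const_mul (Complex.exp (δ * Complex.I))).star
  set U : ℝ → ℂ := fun x => Complex.exp (δ * Complex.I) * ψ x -
    starRingEnd ℂ (Complex.exp (δ * Complex.I) * ψ x) with hU
  set W : ℝ → ℂ := fun x => Complex.exp (δ * Complex.I) * w x -
    starRingEnd ℂ (Complex.exp (δ * Complex.I) * w x) with hW
  have hconj : starRingEnd ℂ (Complex.exp (δ * Complex.I)) = Complex.exp (-(δ * Complex.I)) := by
    rw [← Complex.exp_conj]; simp
  have hU0 : ∀ x, 0 ≤ x → U x ≠ 0 := by
    intro x hx h0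
    rw [hU] at h0
    simp only [map_mul, hconj] at h0
    have h1 := h.phase_eq x hx
    have h2 := h.ne_zero x hx
    have h3 : starRingEnd ℂ (ψ x) ≠ 0 := (map_ne_zero _).2 h2
    have h4 : Complex.exp (δ * Complex.I) * Complex.exp (-(δ * Complex.I)) = 1 := by
      rw [← Complex.exp_add]; simp
    have h5 : Complex.exp (2 * ((θ x + δ : ℝ) : ℂ) * Complex.I) = 1 := by
      have : Complex.exp (2 * ((θ x + δ : ℝ) : ℂ) * Complex.I) =
          Complex.exp (θ x * Complex.I) ^ 2 * Complex.exp (δ * Complex.I) ^ 2 := by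
        rw [← Complex.exp_nat_mul, ← Complex.exp_nat_mul, ← Complex.exp_add]
        congr 1
        push_cast
        ring
      rw [this]
      apply mul_left_cancel₀ h3
      rw [← mul_assoc, h1]
      linear_combination Complex.exp (δ * Complex.I) * h0 + starRingEnd ℂ (ψ x) * h4
    obtain ⟨n, hn⟩ := Complex.exp_eq_one_iff.1 h5
    have h6 : θ x + δ = n * Real.pi := by
      have h7 : ((θ x + δ : ℝ) : ℂ) = ((n * Real.pi : ℝ) : ℂ) := by
        apply mul_left_cancel₀ (mul_ne_zero two_ne_zero Complex.I_ne_zero)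
        push_cast at hn ⊢
        linear_combination hn
      exact_mod_cast h7
    have h8 := hθ0 x hx
    have h9 := hθM x hx
    have hp := Real.pi_pos
    have h10 : (0 : ℝ) < n := by
      by_contra hc
      nlinarith
    have h11 : (n : ℝ) < 1 := by
      by_contra hc
      nlinarith
    have h12 : (0 : ℤ) < n := by exact_mod_cast h10
    have h13 : n < (1 : ℤ) := by exact_mod_cast h11
    omega
  have hτ := hsol.snd.mul (hsol.fst.inv hU0)
  set τ : ℝ → ℂ := fun x => W x * (U x)⁻¹ with hτdef
  have hτreal : ∀ x, starRingEnd ℂ (τ x) = τ x := by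
    intro x
    simp only [hτdef, hU, hW, map_mul, map_sub, map_inv₀, Complex.conj_conj]
    rw [← neg_sub, ← neg_sub (Complex.exp (δ * Complex.I) * ψ x), inv_neg, neg_mul_neg]
  have hγeq : ∀ x, (((σ x : ℂ) + τ x).re : ℂ) = σ x + τ x := fun x =>
    Complex.conj_eq_iff_re.1 (by rw [map_add, hτreal, Complex.conj_ofReal])
  have hγ : MemL2Loc fun x => ((σ x : ℂ) + τ x).re := by
    intro b
    have hc := hτ.continuousOn.mono (Icc_subset_Ici_self : Icc 0 b ⊆ _)
    obtain ⟨K, hK⟩ := isCompact_Icc.exists_bound_of_continuousOn hc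
    have h1 : MemLp τ 2 (volume.restrict (Icc 0 b)) :=
      MemLp.of_bound (hc.aestronglyMeasurable measurableSet_Icc) K
        ((ae_restrict_iff' measurableSet_Icc).2 (Filter.Eventually.of_forall hK))
    exact ((hσ b).add h1).re
  refine ⟨_, -τ 0, hγ, fun x hx => ?_⟩
  have e := (hτ.add hγ.hasACDeriv_integral_sq).eq_of_ae_zero (by
    filter_upwards [ae_pos_halfLine] with x hx
    have h1 := hU0 x hx.le
    rw [hγeq]
    simp only [hτdef]
    change (-(σ x : ℂ) * W x - (σ x : ℂ) ^ 2 * U x) * (U x)⁻¹ +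
      W x * (-((σ x : ℂ) * U x + W x) / U x ^ 2) + ((σ x : ℂ) + W x * (U x)⁻¹) ^ 2 = 0
    field_simp
    ring) hx
  simp only [intervalIntegral.integral_same, Complex.ofReal_zero, add_zero] at e
  rw [hγeq]
  linear_combination -e

theorem mainTheorem8 (s : ℝ → ℂ) (hs : MemL2Loc s) :
    IsSemibounded (minimalOperator s) ↔
      ∃ (γ : ℝ → ℝ) (b : ℝ) (C : ℂ), MemL2Loc γ ∧
        ∀ᵐ x ∂halfLine,
          s x = (b : ℂ) * x + γ x + ((∫ t in (0 : ℝ)..x, γ t ^ 2 : ℝ) : ℂ) + C := by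
  refine ⟨fun h => ?_, fun ⟨γ, b, C, hγ, h⟩ => isSemibounded_of_representation hγ h⟩
  obtain ⟨m, hm⟩ := (isSemibounded_minimalOperator_iff s).1 h
  obtain ⟨c, hc⟩ := exists_ae_im_eq_const hs fun p hp => by
    obtain ⟨r, -, hr⟩ := hm p hp
    rw [hr, Complex.ofReal_im]
  -- Subtracting the slope `m - 1` instead of `m` leaves a form bounded below by `1`, the margin
  -- that the phase bound uses.
  have hdecomp : ∀ᵐ x ∂halfLine, s x = (((s x).re - (m - 1) * x : ℝ) : ℂ) +
      (c * Complex.I + ((m - 1 : ℝ) : ℂ) * x) := by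
    filter_upwards [hc] with x hx
    rw [← hx]
    conv_lhs => rw [← Complex.re_add_im (s x)]
    push_cast
    ring
  have hσ : MemL2Loc fun x => (((s x).re - (m - 1) * x : ℝ) : ℂ) := by
    intro b
    have h1 : MemLp (fun x : ℝ => (m - 1) * x) 2 (volume.restrict (Icc 0 b)) := by
      have hcont : ContinuousOn (fun x : ℝ => (m - 1) * x) (Icc 0 b) := by fun_prop
      obtain ⟨K, hK⟩ := isCompact_Icc.exists_bound_of_continuousOn hcont
      exact MemLp.of_bound (hcont.aestronglyMeasurable measurableSet_Icc) K
        ((ae_restrict_iff' measurableSet_Icc).2 (Filter.Eventually.of_forall hK))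
    exact ((hs b).re.sub h1).ofReal
  obtain ⟨γ, C, hγ, hrep⟩ := exists_riccati_of_form_ge hσ fun p hp => by
    obtain ⟨r, hr, e⟩ := hm _ (minimalGraph_shift hdecomp hp)
    refine ⟨r, hr, ?_⟩
    rw [inner_add_right, inner_smul_right, inner_self_eq_norm_sq_to_K] at e
    simp only [Complex.coe_algebraMap] at e
    push_cast at e ⊢
    linear_combination e
  refine ⟨γ, m - 1, C + c * Complex.I, hγ, ?_⟩
  filter_upwards [hdecomp, ae_pos_halfLine] with x h1 h2
  rw [h1, hrep x h2.le]
  ring
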